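/- Let $(M^n,g)$, $n\ge 3$, be a non-empty compact smooth Riemannian manifold without boundary, with scalar curvature $R$ and Riemannian volume measure $dv_g$. Let $V$ be a smooth vector field on $M$ and $c\in\mathbb R$ a constant such that $(g,V,c)$ is a Yamabe soliton, i.e. $$\mathcal L_V g = 2(R-c)\,g .$$ Then $R$ and $R^2$ are integrable and $$c\int_M R\,dv_g=\int_M R^2\,dv_g ;$$ in particular, if $\int_M R\,dv_g\neq 0$, then $$c=\frac{\int_M R^2\,dv_g}{\int_M R\,dv_g}.$$ Moreover, if $R\ge\alpha$ on $M$ for some constant $\alpha>0$, then $c\ge\alpha$; in particular $c>0$, i.e. the soliton is expanding. -/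

import Mathlib

open scoped Manifold ContDiff

noncomputable section

namespace YamabeSoliton

/-- `ℝⁿ`, the model space of `n`-dimensional manifolds. -/
abbrev Model (n : ℕ) : Type := EuclideanSpace ℝ (Fin n)

/-! ### Coordinate expressions on (open subsets of) `ℝⁿ`

In this section `G : ℝⁿ → Matrix` stands for the matrix `(g_ij)` of the components of a Riemannian
metric in a coordinate system. -/

section Coordinates

variable {n : ℕ}

/-- The partial derivative `∂_i f` at `y`. -/
def partialDeriv (i : Fin n) (f : Model n → ℝ) (y : Model n) : ℝ :=
  fderiv ℝ f y (EuclideanSpace.single i 1)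

/-- The Christoffel symbols
`Γ^k_ij = 1/2 ∑_l g^{kl} (∂_i g_jl + ∂_j g_il - ∂_l g_ij)` of the Levi-Civita connection. -/
def christoffel (G : Model n → Matrix (Fin n) (Fin n) ℝ) (k i j : Fin n) (y : Model n) : ℝ :=
  (1 / 2 : ℝ) * ∑ l, (G y)⁻¹ k l *
    (partialDeriv i (fun z => G z j l) y + partialDeriv j (fun z => G z i l) y
      - partialDeriv l (fun z => G z i j) y)

/-- The components of the Riemann curvature tensor, `Rm(∂_i, ∂_j) ∂_k = ∑_l (riemann l k i j) ∂_l`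
with `Rm(X, Y) Z = ∇_X ∇_Y Z - ∇_Y ∇_X Z - ∇_[X,Y] Z`. -/
def riemann (G : Model n → Matrix (Fin n) (Fin n) ℝ) (l k i j : Fin n) (y : Model n) : ℝ :=
  partialDeriv i (christoffel G l j k) y - partialDeriv j (christoffel G l i k) y
    + ∑ m, (christoffel G l i m y * christoffel G m j k y
      - christoffel G l j m y * christoffel G m i k y)

/-- The Ricci curvature `Ric_jk = ∑_i Rm^i_{kij}`, the trace of `X ↦ Rm(X, ∂_j) ∂_k`. -/
def ricci (G : Model n → Matrix (Fin n) (Fin n) ℝ) (j k : Fin n) (y : Model n) : ℝ :=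
  ∑ i, riemann G i k i j y

/-- The scalar curvature `∑_{j,k} g^{jk} Ric_jk` (positive on round spheres). -/
def scalarCoord (G : Model n → Matrix (Fin n) (Fin n) ℝ) (y : Model n) : ℝ :=
  ∑ j, ∑ k, (G y)⁻¹ j k * ricci G j k y

/-- The components `(£_V g)_ij = ∑_k (V^k ∂_k g_ij + g_kj ∂_i V^k + g_ik ∂_j V^k)` of the Lie
derivative of the metric along a vector field with components `V^k`. -/
def lieDerivCoord (G : Model n → Matrix (Fin n) (Fin n) ℝ) (V : Model n → Model n)
    (i j : Fin n) (y : Model n) : ℝ :=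
  ∑ k, (V y k * partialDeriv k (fun z => G z i j) y
    + G y k j * partialDeriv i (fun z => V z k) y
    + G y i k * partialDeriv j (fun z => V z k) y)

end Coordinates

/-! ### Riemannian manifolds -/

section Riemannian

variable {n : ℕ} {M : Type*} [TopologicalSpace M] [ChartedSpace (Model n) M]
  [IsManifold (𝓡 n) ∞ M]

/-- A smooth Riemannian metric on the smooth `n`-manifold `M`. -/
abbrev Metric (n : ℕ) (M : Type*) [TopologicalSpace M] [ChartedSpace (Model n) M]
    [IsManifold (𝓡 n) ∞ M] : Type _ :=
  Bundle.ContMDiffRiemannianMetric (𝓡 n) ∞ (Model n) (fun x : M => TangentSpace (𝓡 n) x)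

/-- The coordinate vector field `∂_i` of the chart `e`, at the point with coordinates `y`. -/
def coordVec (e : OpenPartialHomeomorph M (Model n)) (i : Fin n) (y : Model n) :
    TangentSpace (𝓡 n) (e.symm y) :=
  mfderiv (𝓡 n) (𝓡 n) e.symm y (EuclideanSpace.single i (1 : ℝ) : Model n)

/-- The matrix `g_ij = g(∂_i, ∂_j)` of the metric in the chart `e`, as a function of the
coordinates. -/
def gram (g : Metric n M) (e : OpenPartialHomeomorph M (Model n)) (y : Model n) :
    Matrix (Fin n) (Fin n) ℝ :=
  Matrix.of fun i j => g.inner (e.symm y) (coordVec e i y) (coordVec e j y)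

/-- The components of the vector field `V` in the chart `e`, as functions of the coordinates. -/
def vecCoord (V : ∀ x : M, TangentSpace (𝓡 n) x) (e : OpenPartialHomeomorph M (Model n))
    (y : Model n) : Model n :=
  mfderiv (𝓡 n) (𝓡 n) e (e.symm y) (V (e.symm y))

/-- The scalar curvature of `(M, g)`, a function on `M`; its value at `x` is computed in the
preferred chart at `x` (the scalar curvature does not depend on the chart). -/
def scalarCurvature (g : Metric n M) (x : M) : ℝ :=
  scalarCoord (gram g (chartAt (Model n) x)) (chartAt (Model n) x x)

/-- `V` is a smooth vector field on `M`. -/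
def IsSmoothVectorField (V : ∀ x : M, TangentSpace (𝓡 n) x) : Prop :=
  ContMDiff (𝓡 n) (𝓡 n).tangent ∞ fun x => (⟨x, V x⟩ : TangentBundle (𝓡 n) M)

/-- `(g, V, c)` is a Yamabe soliton on `M`: `V` is a smooth vector field and
`£_V g = 2 (R - c) g`, where `R` is the scalar curvature of `g`. The equation is written in
components, in all charts of the atlas. -/
structure IsYamabeSoliton (g : Metric n M) (V : ∀ x : M, TangentSpace (𝓡 n) x) (c : ℝ) :
    Prop where
  smooth : IsSmoothVectorField V
  lieDeriv_eq : ∀ e ∈ atlas (Model n) M, ∀ y ∈ e.target, ∀ i j : Fin n,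
    lieDerivCoord (gram g e) (vecCoord V e) i j y
      = 2 * (-c + scalarCurvature g (e.symm y)) * gram g e y i j

/-- A Yamabe soliton with soliton constant `c` is expanding if `c > 0`. -/
def IsExpanding (c : ℝ) : Prop := 0 < c

/-- The Riemannian measure of the domain of the chart `e`, as a measure on `M`:
`√det(g_ij) dy^1 ⋯ dy^n` in coordinates, and `0` outside the domain of `e`. -/
def chartVolume [MeasurableSpace M] (g : Metric n M)
    (e : OpenPartialHomeomorph M (Model n)) : MeasureTheory.Measure M :=
  ((MeasureTheory.volume.restrict e.target).withDensity
    fun y => ENNReal.ofReal (√(gram g e y).det)).map e.symm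

/-- The Riemannian volume measure `dv_g` of `(M, g)`, glued from its restrictions `chartVolume g e`
to the chart domains. Since these agree on overlaps, `dv_g` is the smallest measure
that dominates all of them. -/
def volumeMeasure [MeasurableSpace M] (g : Metric n M) : MeasureTheory.Measure M :=
  ⨆ e ∈ atlas (Model n) M, chartVolume g e

end Riemannian

end YamabeSoliton

end

noncomputable section

set_option maxSynthPendingDepth 4

namespace YamabeSoliton

/-! ### Connection forms on a vector space: curvature and the second Bianchi identity. -/

section BilinearCalculus

variable {E F : Type*} [NormedAddCommGroup E] [NormedSpace ℝ E]
  [NormedAddCommGroup F] [NormedSpace ℝ F]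

/-! The soliton equation says that V is a conformal field with factor φ = R - c. Feed V to the
Einstein tensor: W = Ric(V) - (R/2) V. In div W the derivatives of Ric and of R cancel by the
contracted second Bianchi identity dR = 2 div Ric (`fderiv_scalarTrace`). Since Ric is symmetric, it
only sees the symmetric part φ g of ∇V, so tr(Ric ∘ ∇V) = φ R, while tr ∇V = n φ. Hence div W = (1 -
n/2)(R - c) R (`divergence_einsteinField`). The divergence theorem on a closed manifold and n ≠ 2
then give ∫ (R - c) R = 0. If R ≥ α > 0, then R² ≥ α R, and dividing c ∫ R = ∫ R² ≥ α ∫ R by ∫ R > 0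
gives c ≥ α.

The local geometry is done in one chart, with metric, connection and curvature as functions on ℝⁿ
valued in continuous multilinear maps. All tensor identities follow from the axioms in
`IsLeviCivitaOn`; the index formulas of the statement are matched with this calculus by
`IsMetricOn.isLeviCivitaOn`, `scalarCoord_eq` and `lieDerivCoord_eq`.

To globalize, transition maps are isometries of the coordinate metrics, and isometries preserve the
connection, the curvature, R and W (`IsIsometryOn`). W is never built as a section of the tangent
bundle: only its components in each chart and the derivation f ↦ W f are used. With a partition of
unity ρ_k subordinate to charts, integration by parts in a single chart gives ∫ ρ_k div W = -∫ W
ρ_k, and Σ W ρ_k = W 1 = 0. -/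

lemma fderiv_clm_apply_apply {Φ : E → E →L[ℝ] E →L[ℝ] F} {X Y : E → E} {y : E}
    (hΦ : DifferentiableAt ℝ Φ y) (hX : DifferentiableAt ℝ X y) (hY : DifferentiableAt ℝ Y y)
    (t : E) :
    fderiv ℝ (fun z => Φ z (X z) (Y z)) y t
      = fderiv ℝ Φ y t (X y) (Y y) + Φ y (fderiv ℝ X y t) (Y y)
        + Φ y (X y) (fderiv ℝ Y y t) := by
  rw [((hΦ.hasFDerivAt.clm_apply hX.hasFDerivAt).clm_apply hY.hasFDerivAt).fderiv]
  simp
  abel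

lemma fderiv_clm_const_apply {Φ : E → E →L[ℝ] F} {y : E}
    (hΦ : DifferentiableAt ℝ Φ y) (t u : E) :
    fderiv ℝ (fun z => Φ z u) y t = fderiv ℝ Φ y t u := by
  rw [(hΦ.hasFDerivAt.clm_apply (hasFDerivAt_const u y)).fderiv]
  simp

lemma fderiv_clm_const_apply_apply {Φ : E → E →L[ℝ] E →L[ℝ] F} {y : E}
    (hΦ : DifferentiableAt ℝ Φ y) (t u v : E) :
    fderiv ℝ (fun z => Φ z u v) y t = fderiv ℝ Φ y t u v := by
  rw [fderiv_clm_apply_apply hΦ (differentiableAt_const u) (differentiableAt_const v)]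
  simp

/-- The bilinear map `(u, t) ↦ A t ∘ A u`. -/
def connSq (A : E →L[ℝ] E →L[ℝ] E) : E →L[ℝ] E →L[ℝ] E →L[ℝ] E :=
  ((ContinuousLinearMap.compL ℝ E E E).comp A).flip.comp A

@[simp] lemma connSq_apply (A : E →L[ℝ] E →L[ℝ] E) (u t v : E) :
    connSq A u t v = A t (A u v) := rfl

/-- The curvature `Ω(t, u) = ∂_t Γ_u - ∂_u Γ_t + [Γ_t, Γ_u]` of a connection form `Γ`. -/
def curv (Γ : E → E →L[ℝ] E →L[ℝ] E) (y : E) : E →L[ℝ] E →L[ℝ] E →L[ℝ] E :=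
  fderiv ℝ Γ y - (fderiv ℝ Γ y).flip + ((connSq (Γ y)).flip - connSq (Γ y))

lemma curv_apply (Γ : E → E →L[ℝ] E →L[ℝ] E) (y t u v : E) :
    curv Γ y t u v = fderiv ℝ Γ y t u v - fderiv ℝ Γ y u t v
      + (Γ y t (Γ y u v) - Γ y u (Γ y t v)) := rfl

lemma curv_antisymm (Γ : E → E →L[ℝ] E →L[ℝ] E) (y t u v : E) :
    curv Γ y t u v = - curv Γ y u t v := by
  simp only [curv_apply]; abel

lemma contDiffAt_flip {G : Type*} [NormedAddCommGroup G] [NormedSpace ℝ G]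
    {A : G → E →L[ℝ] E →L[ℝ] F} {y : G} {m : WithTop ℕ∞} (h : ContDiffAt ℝ m A y) :
    ContDiffAt ℝ m (fun z => (A z).flip) y :=
  (ContinuousLinearMap.flipₗᵢ ℝ E E F).toContinuousLinearEquiv.contDiff.contDiffAt.comp y h

lemma contDiffAt_connSq {Γ : E → E →L[ℝ] E →L[ℝ] E} {y : E} {m : WithTop ℕ∞}
    (h : ContDiffAt ℝ m Γ y) : ContDiffAt ℝ m (fun z => connSq (Γ z)) y := by
  have h1 : ContDiffAt ℝ m (fun z => (ContinuousLinearMap.compL ℝ E E E).comp (Γ z)) y :=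
    contDiffAt_const.clm_comp h
  have h2 : ContDiffAt ℝ m
      (fun z => ((ContinuousLinearMap.compL ℝ E E E).comp (Γ z)).flip) y :=
    (ContinuousLinearMap.flipₗᵢ ℝ E (E →L[ℝ] E)
      (E →L[ℝ] E)).toContinuousLinearEquiv.contDiff.contDiffAt.comp y h1
  exact h2.clm_comp h

lemma contDiffAt_fderiv_top {f : E → F} {y : E} (h : ContDiffAt ℝ ∞ f y) :
    ContDiffAt ℝ ∞ (fun z => fderiv ℝ f z) y :=
  h.fderiv_right (by simp)

lemma contDiffAt_curv {Γ : E → E →L[ℝ] E →L[ℝ] E} {y : E}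
    (h : ContDiffAt ℝ ∞ Γ y) : ContDiffAt ℝ ∞ (curv Γ) y :=
  ((contDiffAt_fderiv_top h).sub (contDiffAt_flip (contDiffAt_fderiv_top h))).add
    ((contDiffAt_flip (contDiffAt_connSq h)).sub (contDiffAt_connSq h))

lemma fderiv_fderiv_symm {f : E → F} {y : E} (h : ContDiffAt ℝ ∞ f y) (s t : E) :
    fderiv ℝ (fderiv ℝ f) y s t = fderiv ℝ (fderiv ℝ f) y t s :=
  ((h.of_le (m := 2) (WithTop.coe_le_coe.2 (le_top : (2 : ℕ∞) ≤ ⊤))).isSymmSndFDerivAt (by simp)) s t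

/-- Product rule with t, u, v frozen. Written in Γ and its first two derivatives, the Bianchi
identity becomes a cancellation of terms in an abelian group. -/
lemma fderiv_curv {Γ : E → E →L[ℝ] E →L[ℝ] E} {y : E}
    (h : ContDiffAt ℝ ∞ Γ y) (s t u v : E) :
    fderiv ℝ (curv Γ) y s t u v
      = fderiv ℝ (fderiv ℝ Γ) y s t u v - fderiv ℝ (fderiv ℝ Γ) y s u t v
        + (fderiv ℝ Γ y s t (Γ y u v) + Γ y t (fderiv ℝ Γ y s u v)
          - (fderiv ℝ Γ y s u (Γ y t v) + Γ y u (fderiv ℝ Γ y s t v))) := by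
  have hd : DifferentiableAt ℝ Γ y := h.differentiableAt (by simp)
  have hd2 : DifferentiableAt ℝ (fderiv ℝ Γ) y :=
    (contDiffAt_fderiv_top h).differentiableAt (by simp)
  have hc : DifferentiableAt ℝ (curv Γ) y := (contDiffAt_curv h).differentiableAt (by simp)
  have e0 : fderiv ℝ (curv Γ) y s t u v = fderiv ℝ (fun z => curv Γ z t u v) y s := by
    rw [← fderiv_clm_const_apply_apply hc,
      ← fderiv_clm_const_apply (Φ := fun z => curv Γ z t u)]
    exact (hc.clm_apply (differentiableAt_const t)).clm_apply (differentiableAt_const u)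
  have k1 : ∀ t u v : E, HasFDerivAt (fun z => fderiv ℝ Γ z t u v)
      (fderiv ℝ (fun z => fderiv ℝ Γ z t u v) y) y := fun t u v =>
    (((hd2.clm_apply (differentiableAt_const t)).clm_apply (differentiableAt_const u)).clm_apply
      (differentiableAt_const v)).hasFDerivAt
  have k2 : ∀ u v : E, DifferentiableAt ℝ (fun z => Γ z u v) y := fun u v =>
    (hd.clm_apply (differentiableAt_const u)).clm_apply (differentiableAt_const v)
  have k3 : ∀ t u v : E, HasFDerivAt (fun z => Γ z t (Γ z u v))
      (fderiv ℝ (fun z => Γ z t (Γ z u v)) y) y := fun t u v =>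
    ((hd.clm_apply (differentiableAt_const t)).clm_apply (k2 u v)).hasFDerivAt
  have d1 : ∀ t u v : E, fderiv ℝ (fun z => fderiv ℝ Γ z t u v) y s
      = fderiv ℝ (fderiv ℝ Γ) y s t u v := fun t u v => by
    rw [← fderiv_clm_const_apply_apply hd2,
      ← fderiv_clm_const_apply (Φ := fun z => fderiv ℝ Γ z t u)]
    exact (hd2.clm_apply (differentiableAt_const t)).clm_apply (differentiableAt_const u)
  have d3 : ∀ t u v : E, fderiv ℝ (fun z => Γ z t (Γ z u v)) y s
      = fderiv ℝ Γ y s t (Γ y u v) + Γ y t (fderiv ℝ Γ y s u v) := fun t u v => by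
    rw [fderiv_clm_apply_apply (X := fun _ => t) hd (differentiableAt_const t) (k2 u v),
      fderiv_clm_const_apply_apply hd]
    simp
  have hall : HasFDerivAt (fun z => curv Γ z t u v) _ y :=
    ((k1 t u v).sub (k1 u t v)).add ((k3 t u v).sub (k3 u t v))
  rw [e0, hall.fderiv]
  simp [d1, d3]

/-- The covariant derivative `(∇_s Ω)(t, u) v` of the curvature. -/
def covCurv (Γ : E → E →L[ℝ] E →L[ℝ] E) (y s t u v : E) : E :=
  fderiv ℝ (curv Γ) y s t u v + Γ y s (curv Γ y t u v) - curv Γ y t u (Γ y s v)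
    - curv Γ y (Γ y s t) u v - curv Γ y t (Γ y s u) v

lemma covCurv_antisymm {Γ : E → E →L[ℝ] E →L[ℝ] E} {y : E} (h : ContDiffAt ℝ ∞ Γ y)
    (s t u v : E) : covCurv Γ y s t u v = - covCurv Γ y s u t v := by
  unfold covCurv
  rw [curv_antisymm Γ y t u v, curv_antisymm Γ y t u, curv_antisymm Γ y (Γ y s t),
    curv_antisymm Γ y t (Γ y s u), fderiv_curv h, fderiv_curv h, map_neg]
  abel

/-- The second Bianchi identity. -/
lemma covCurv_cyclic {Γ : E → E →L[ℝ] E →L[ℝ] E} {y : E} (h : ContDiffAt ℝ ∞ Γ y)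
    (hs : ∀ u v, Γ y u v = Γ y v u) (s t u v : E) :
    covCurv Γ y s t u v + covCurv Γ y t u s v + covCurv Γ y u s t v = 0 := by
  unfold covCurv
  -- In the cyclic sum, the Γ-corrections in the two form slots cancel in pairs because Γ is
  -- torsion-free; the second derivatives of Γ cancel below by Schwarz.
  rw [curv_antisymm Γ y t (Γ y s u), curv_antisymm Γ y u (Γ y t s),
    curv_antisymm Γ y s (Γ y u t), hs u s, hs t s, hs u t]
  simp only [fderiv_curv h, curv_apply]
  rw [fderiv_fderiv_symm h t s, fderiv_fderiv_symm h u s, fderiv_fderiv_symm h u t]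
  simp only [map_sub, map_add]
  abel

end BilinearCalculus

/-! ### Axioms for a Levi-Civita connection in coordinates. -/

section LeviCivita

/-- `Γ` is the Levi-Civita connection of the metric `B` on the open set `U`, and `θ m` is the
vector field dual to the `m`-th coordinate. -/
structure IsLeviCivitaOn {n : ℕ} (B : Model n → Model n →L[ℝ] Model n →L[ℝ] ℝ)
    (Γ : Model n → Model n →L[ℝ] Model n →L[ℝ] Model n) (θ : Fin n → Model n → Model n)
    (U : Set (Model n)) : Prop where
  isOpen : IsOpen U
  smooth_metric : ∀ y ∈ U, ContDiffAt ℝ ∞ B y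
  smooth_conn : ∀ y ∈ U, ContDiffAt ℝ ∞ Γ y
  smooth_dual : ∀ m, ∀ y ∈ U, ContDiffAt ℝ ∞ (θ m) y
  metric_symm : ∀ y ∈ U, ∀ u v, B y u v = B y v u
  conn_symm : ∀ y ∈ U, ∀ u v, Γ y u v = Γ y v u
  compat : ∀ y ∈ U, ∀ t u v, fderiv ℝ B y t u v = B y (Γ y t u) v + B y u (Γ y t v)
  metric_dual : ∀ m, ∀ y ∈ U, ∀ v, B y (θ m y) v = v m

variable {n : ℕ} {B : Model n → Model n →L[ℝ] Model n →L[ℝ] ℝ}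
  {Γ : Model n → Model n →L[ℝ] Model n →L[ℝ] Model n} {θ : Fin n → Model n → Model n}
  {U : Set (Model n)}

/-- The `i`-th standard basis vector. -/
abbrev stdVec {n : ℕ} (i : Fin n) : Model n := EuclideanSpace.single i 1

lemma sum_smul_stdVec (v : Model n) : ∑ i, v i • stdVec i = v := by
  ext j
  simp [Finset.sum_apply, Pi.single_apply]

namespace IsLeviCivitaOn

variable (h : IsLeviCivitaOn B Γ θ U) {y : Model n} (hy : y ∈ U)
include h hy

/-- The dual fields make the metric nondegenerate: pairing with `θ m` reads off the m-th component.
-/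
lemma metric_ext {u v : Model n} (huv : ∀ w, B y u w = B y v w) : u = v := by
  ext m
  rw [← h.metric_dual m y hy u, ← h.metric_dual m y hy v, h.metric_symm y hy, huv,
    h.metric_symm y hy]

end IsLeviCivitaOn
end LeviCivita

/-! ### Symmetries of the curvature, Ricci tensor and contracted Bianchi identity. -/

section

variable {n : ℕ} {B : Model n → Model n →L[ℝ] Model n →L[ℝ] ℝ}
  {Γ : Model n → Model n →L[ℝ] Model n →L[ℝ] Model n} {θ : Fin n → Model n → Model n}
  {U : Set (Model n)}

/-- The Ricci tensor of the connection `Γ`, the trace of `X ↦ Ω(X, u) v`. -/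
def ricciForm (Γ : Model n → Model n →L[ℝ] Model n →L[ℝ] Model n) (y u v : Model n) : ℝ :=
  ∑ i, curv Γ y (stdVec i) u v i

/-- The Ricci endomorphism `u ↦ ∑_m Ω(u, e_m) θ_m`. -/
def ricciEndo (Γ : Model n → Model n →L[ℝ] Model n →L[ℝ] Model n)
    (θ : Fin n → Model n → Model n) (y : Model n) : Model n →L[ℝ] Model n :=
  ∑ m, ((curv Γ y).flip (stdVec m)).flip (θ m y)

lemma ricciEndo_apply (y u : Model n) :
    ricciEndo Γ θ y u = ∑ m, curv Γ y u (stdVec m) (θ m y) := by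
  simp [ricciEndo]

/-- The scalar curvature, as the trace of the Ricci endomorphism. -/
def scalarTrace (Γ : Model n → Model n →L[ℝ] Model n →L[ℝ] Model n)
    (θ : Fin n → Model n → Model n) (y : Model n) : ℝ :=
  ∑ i, ricciEndo Γ θ y (stdVec i) i

lemma sum_apply_smul_map_stdVec {F : Type*} [AddCommGroup F] [Module ℝ F] [TopologicalSpace F]
    (A : Model n →L[ℝ] F) (v : Model n) : ∑ i, v i • A (stdVec i) = A v := by
  conv_rhs => rw [← sum_smul_stdVec v]
  simp

/-- `tr (A ∘ C) = tr (C ∘ A)`. -/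
lemma sum_comp_comm (A C : Model n →L[ℝ] Model n) :
    ∑ i, A (C (stdVec i)) i = ∑ i, C (A (stdVec i)) i := by
  have h (A C : Model n →L[ℝ] Model n) (i : Fin n) :
      A (C (stdVec i)) i = ∑ k, C (stdVec i) k * A (stdVec k) i := by
    rw [← sum_apply_smul_map_stdVec A (C (stdVec i))]
    simp
  simp only [h A C, h C A]
  rw [Finset.sum_comm]
  simp only [mul_comm]

namespace IsLeviCivitaOn

variable (h : IsLeviCivitaOn B Γ θ U) {y : Model n} (hy : y ∈ U)
include h hy

lemma mem_nhds : U ∈ nhds y := h.isOpen.mem_nhds hy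

lemma diff_metric : DifferentiableAt ℝ B y := (h.smooth_metric y hy).differentiableAt (by simp)

lemma diff_conn : DifferentiableAt ℝ Γ y := (h.smooth_conn y hy).differentiableAt (by simp)

lemma diff_dual (m : Fin n) : DifferentiableAt ℝ (θ m) y :=
  (h.smooth_dual m y hy).differentiableAt (by simp)

lemma diff_curv : DifferentiableAt ℝ (curv Γ) y :=
  (contDiffAt_curv (h.smooth_conn y hy)).differentiableAt (by simp)

lemma fderiv_conn_symm (t u v : Model n) : fderiv ℝ Γ y t u v = fderiv ℝ Γ y t v u := by
  rw [← fderiv_clm_const_apply_apply (h.diff_conn hy),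
    ← fderiv_clm_const_apply_apply (h.diff_conn hy)]
  congr 1
  apply Filter.EventuallyEq.fderiv_eq
  filter_upwards [h.mem_nhds hy] with z hz using h.conn_symm z hz u v

/-- The first Bianchi identity. -/
lemma curv_cyclic (t u v : Model n) :
    curv Γ y t u v + curv Γ y u v t + curv Γ y v t u = 0 := by
  simp only [curv_apply]
  rw [h.fderiv_conn_symm hy t u v, h.fderiv_conn_symm hy u v t, h.fderiv_conn_symm hy v t u,
    h.conn_symm y hy v t, h.conn_symm y hy u v, h.conn_symm y hy t u]
  abel

/-- Metric compatibility for variable fields: t⟨X, Y⟩ = ⟨∇_t X, Y⟩ + ⟨X, ∇_t Y⟩. -/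
lemma fderiv_metric_apply {X Y : Model n → Model n} (hX : DifferentiableAt ℝ X y)
    (hY : DifferentiableAt ℝ Y y) (t : Model n) :
    fderiv ℝ (fun z => B z (X z) (Y z)) y t
      = B y (fderiv ℝ X y t + Γ y t (X y)) (Y y) + B y (X y) (fderiv ℝ Y y t + Γ y t (Y y)) := by
  rw [fderiv_clm_apply_apply (h.diff_metric hy) hX hY, h.compat y hy]
  simp only [map_add, _root_.add_apply]
  ring

/-- Differentiating the compatibility equation once more expresses the second derivative of `B`
through Γ. It is symmetric in the two directions; antisymmetrizing kills the mixed terms ⟨Γ_t a, Γ_s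
b⟩ + ⟨Γ_s a, Γ_t b⟩ and leaves the action of the curvature on `B`. -/
lemma curv_skew (t u a b : Model n) :
    B y (curv Γ y t u a) b + B y a (curv Γ y t u b) = 0 := by
  have key : ∀ s t, fderiv ℝ (fderiv ℝ B) y s t a b
      = B y (fderiv ℝ Γ y s t a + Γ y s (Γ y t a)) b + B y (Γ y t a) (Γ y s b)
        + (B y (Γ y s a) (Γ y t b) + B y a (fderiv ℝ Γ y s t b + Γ y s (Γ y t b))) := by
    intro s t
    have hd2 : DifferentiableAt ℝ (fderiv ℝ B) y :=
      (contDiffAt_fderiv_top (h.smooth_metric y hy)).differentiableAt (by simp)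
    have hΓ (u v : Model n) : DifferentiableAt ℝ (fun z => Γ z u v) y :=
      ((h.diff_conn hy).clm_apply (differentiableAt_const u)).clm_apply (differentiableAt_const v)
    have hc (a : Model n) : DifferentiableAt ℝ (fun _ : Model n => a) y :=
      differentiableAt_const a
    rw [← fderiv_clm_const_apply hd2, ← fderiv_clm_const_apply_apply
      (Φ := fun z => fderiv ℝ B z t) (hd2.clm_apply (differentiableAt_const t))]
    have e : (fun z => fderiv ℝ B z t a b) =ᶠ[nhds y]
        fun z => B z (Γ z t a) b + B z a (Γ z t b) := by
      filter_upwards [h.mem_nhds hy] with z hz using h.compat z hz t a b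
    rw [e.fderiv_eq, fderiv_fun_add, _root_.add_apply,
      h.fderiv_metric_apply hy (hΓ t a) (hc b), h.fderiv_metric_apply hy (hc a) (hΓ t b),
      fderiv_clm_const_apply_apply (h.diff_conn hy), fderiv_clm_const_apply_apply (h.diff_conn hy)]
    · simp
    · exact ((h.diff_metric hy).clm_apply (hΓ t a)).clm_apply (hc b)
    · exact ((h.diff_metric hy).clm_apply (hc a)).clm_apply (hΓ t b)
  have e := fderiv_fderiv_symm (h.smooth_metric y hy) t u
  have e' := DFunLike.congr_fun (DFunLike.congr_fun e a) b
  rw [key t u, key u t] at e'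
  simp only [curv_apply, map_add, map_sub, _root_.add_apply,
    _root_.sub_apply] at e' ⊢
  linarith

/-- Covariant derivative of `curv_skew`: the correction terms are again instances of `curv_skew`,
with Γ inserted in one slot. -/
lemma covCurv_skew (s t u a b : Model n) :
    B y (covCurv Γ y s t u a) b + B y a (covCurv Γ y s t u b) = 0 := by
  have hΩ (v : Model n) : DifferentiableAt ℝ (fun z => curv Γ z t u v) y :=
    (((h.diff_curv hy).clm_apply (differentiableAt_const t)).clm_apply
      (differentiableAt_const u)).clm_apply (differentiableAt_const v)
  have hΩ' (v : Model n) : fderiv ℝ (fun z => curv Γ z t u v) y s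
      = fderiv ℝ (curv Γ) y s t u v := by
    rw [← fderiv_clm_const_apply_apply (h.diff_curv hy),
      ← fderiv_clm_const_apply (Φ := fun z => curv Γ z t u)]
    exact ((h.diff_curv hy).clm_apply (differentiableAt_const t)).clm_apply
      (differentiableAt_const u)
  have hc (a : Model n) : DifferentiableAt ℝ (fun _ : Model n => a) y :=
    differentiableAt_const a
  have e : (fun z => B z (curv Γ z t u a) b + B z a (curv Γ z t u b)) =ᶠ[nhds y]
      fun _ => (0 : ℝ) := by
    filter_upwards [h.mem_nhds hy] with z hz using h.curv_skew hz t u a b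
  have e2 := DFunLike.congr_fun (e.fderiv_eq (𝕜 := ℝ)) s
  rw [fderiv_fun_add, _root_.add_apply, h.fderiv_metric_apply hy (hΩ a) (hc b),
    h.fderiv_metric_apply hy (hc a) (hΩ b), hΩ', hΩ'] at e2
  · have k1 := h.curv_skew hy t u a (Γ y s b)
    have k2 := h.curv_skew hy t u (Γ y s a) b
    have k3 := h.curv_skew hy (Γ y s t) u a b
    have k4 := h.curv_skew hy t (Γ y s u) a b
    unfold covCurv
    simp at e2 ⊢
    linarith
  · exact ((h.diff_metric hy).clm_apply (hΩ a)).clm_apply (hc b)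
  · exact ((h.diff_metric hy).clm_apply (hc a)).clm_apply (hΩ b)

/-- Under the metric `θ m` corresponds to the 1-form dx^m, so this is ∇_t dx^m = -Γ^m_{ta} dx^a; it
comes from differentiating the constant ⟨θ_m, w⟩ = w^m. -/
lemma fderiv_dual (m : Fin n) (t : Model n) :
    fderiv ℝ (θ m) y t = - Γ y t (θ m y) - ∑ a, Γ y t (stdVec a) m • θ a y := by
  apply h.metric_ext hy
  intro w
  have e : (fun z => B z (θ m z) w) =ᶠ[nhds y] fun _ => w m := by
    filter_upwards [h.mem_nhds hy] with z hz using h.metric_dual m z hz w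
  have e2 := DFunLike.congr_fun (e.fderiv_eq (𝕜 := ℝ)) t
  rw [h.fderiv_metric_apply hy (h.diff_dual hy m) (differentiableAt_const w)] at e2
  simp [h.metric_dual m y hy] at e2
  have e3 : Γ y t w m = ∑ a, Γ y t (stdVec a) m * w a := by
    rw [← sum_apply_smul_map_stdVec (Γ y t) w]
    simp [mul_comm]
  simp [h.metric_dual _ y hy]
  linarith

lemma contDiffAt_ricciEndo : ContDiffAt ℝ ∞ (ricciEndo Γ θ) y := by
  apply ContDiffAt.sum
  intro m _
  exact (contDiffAt_flip ((contDiffAt_flip (contDiffAt_curv (h.smooth_conn y hy))).clm_apply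
    contDiffAt_const)).clm_apply (h.smooth_dual m y hy)

lemma diff_ricciEndo : DifferentiableAt ℝ (ricciEndo Γ θ) y :=
  (h.contDiffAt_ricciEndo hy).differentiableAt (by simp)

/-- The covariant derivative of the Ricci endomorphism. -/
lemma fderiv_ricciEndo (t u : Model n) :
    fderiv ℝ (ricciEndo Γ θ) y t u + Γ y t (ricciEndo Γ θ y u) - ricciEndo Γ θ y (Γ y t u)
      = ∑ m, covCurv Γ y t u (stdVec m) (θ m y) := by
  have hΩ (m : Fin n) : DifferentiableAt ℝ (fun z => curv Γ z u (stdVec m)) y :=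
    (((h.diff_curv hy).clm_apply (differentiableAt_const u)).clm_apply
      (differentiableAt_const _))
  have hterm (m : Fin n) : HasFDerivAt (fun z => curv Γ z u (stdVec m) (θ m z)) _ y :=
    ((hΩ m).hasFDerivAt.clm_apply (h.diff_dual hy m).hasFDerivAt)
  have e1 : fderiv ℝ (ricciEndo Γ θ) y t u
      = ∑ m, (fderiv ℝ (curv Γ) y t u (stdVec m) (θ m y)
          + curv Γ y u (stdVec m) (fderiv ℝ (θ m) y t)) := by
    rw [← fderiv_clm_const_apply (h.diff_ricciEndo hy)]
    simp only [ricciEndo_apply]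
    rw [(HasFDerivAt.fun_sum fun m _ => hterm m).fderiv]
    simp only [_root_.sum_apply, _root_.add_apply,
      ContinuousLinearMap.comp_apply, ContinuousLinearMap.flip_apply,
      fderiv_clm_const_apply_apply (h.diff_curv hy)]
    exact Finset.sum_congr rfl fun m _ => add_comm _ _
  -- Summed over m, the derivative of the dual frame moves onto the second curvature slot; it
  -- supplies the correction for `stdVec m` in `covCurv`.
  have e2 : ∑ m, curv Γ y u (stdVec m) (∑ a, Γ y t (stdVec a) m • θ a y)
      = ∑ a, curv Γ y u (Γ y t (stdVec a)) (θ a y) := by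
    simp only [map_sum, map_smul]
    rw [Finset.sum_comm]
    refine Finset.sum_congr rfl fun a _ => ?_
    have := sum_apply_smul_map_stdVec (curv Γ y u) (Γ y t (stdVec a))
    rw [← this]
    simp
  rw [e1]
  simp only [h.fderiv_dual hy, map_sub, map_neg, Finset.sum_add_distrib, Finset.sum_sub_distrib,
    e2]
  simp only [Finset.sum_add_distrib, Finset.sum_sub_distrib, covCurv, ricciEndo_apply, map_sum, Finset.sum_neg_distrib]
  abel

/-- The contracted second Bianchi identity `dR = 2 div Ric`. -/
lemma fderiv_scalarTrace (v : Model n) :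
    fderiv ℝ (scalarTrace Γ θ) y v
      = 2 * ∑ i, (fderiv ℝ (ricciEndo Γ θ) y (stdVec i) v
          + Γ y (stdVec i) (ricciEndo Γ θ y v) - ricciEndo Γ θ y (Γ y (stdVec i) v)) i := by
  have hρ := h.diff_ricciEndo hy
  have hs := h.smooth_conn y hy
  have e1 : fderiv ℝ (scalarTrace Γ θ) y v
      = ∑ i, fderiv ℝ (ricciEndo Γ θ) y v (stdVec i) i := by
    have hterm (i : Fin n) : HasFDerivAt (fun z => ricciEndo Γ θ z (stdVec i) i)
        ((EuclideanSpace.proj i : Model n →L[ℝ] ℝ).comp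
          (fderiv ℝ (fun z => ricciEndo Γ θ z (stdVec i)) y)) y :=
      (EuclideanSpace.proj i : Model n →L[ℝ] ℝ).hasFDerivAt.comp y
        (hρ.clm_apply (differentiableAt_const _)).hasFDerivAt
    unfold scalarTrace
    rw [(HasFDerivAt.fun_sum fun i _ => hterm i).fderiv]
    simp [fderiv_clm_const_apply hρ]
  -- The commutator of Γ_v with the Ricci endomorphism is traceless, so the plain and the covariant
  -- derivative have the same trace.
  have e2 : ∑ i, fderiv ℝ (ricciEndo Γ θ) y v (stdVec i) i
      = ∑ i, (∑ m, covCurv Γ y v (stdVec i) (stdVec m) (θ m y)) i := by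
    simp only [← h.fderiv_ricciEndo hy]
    have := sum_comp_comm (Γ y v) (ricciEndo Γ θ y)
    simp only [PiLp.add_apply, PiLp.sub_apply, Finset.sum_add_distrib, Finset.sum_sub_distrib]
    linarith
  have hT (a b c d : Model n) (i : Fin n) : covCurv Γ y a b c d i
      = B y (θ i y) (covCurv Γ y a b c d) := (h.metric_dual i y hy _).symm
  -- Exchange i and m, then use skewness. This makes the last two terms of the Bianchi identity
  -- contribute equally, whence the factor 2.
  have e3 : ∑ i, ∑ m, covCurv Γ y (stdVec m) v (stdVec i) (θ m y) i
      = - ∑ i, ∑ m, covCurv Γ y (stdVec i) v (stdVec m) (θ m y) i := by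
    rw [Finset.sum_comm, ← Finset.sum_neg_distrib]
    refine Finset.sum_congr rfl fun i _ => ?_
    rw [← Finset.sum_neg_distrib]
    refine Finset.sum_congr rfl fun m _ => ?_
    have := h.covCurv_skew hy (stdVec i) v (stdVec m) (θ i y) (θ m y)
    rw [hT, hT, h.metric_symm y hy (θ m y)]
    linarith
  rw [e1, e2]
  simp only [h.fderiv_ricciEndo hy, WithLp.ofLp_sum, Finset.sum_apply]
  have e4 (i m : Fin n) : covCurv Γ y v (stdVec i) (stdVec m) (θ m y) i
      = covCurv Γ y (stdVec i) v (stdVec m) (θ m y) i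
        - covCurv Γ y (stdVec m) v (stdVec i) (θ m y) i := by
    have := congrArg (fun w : Model n => w i) (covCurv_cyclic hs (h.conn_symm y hy)
      v (stdVec i) (stdVec m) (θ m y))
    rw [covCurv_antisymm hs (stdVec i)] at this
    simp only [PiLp.add_apply, PiLp.neg_apply, PiLp.zero_apply] at this
    linarith
  simp only [e4, Finset.sum_sub_distrib, e3]
  ring

/-- Skewness moves Ω(u, e_m) from θ_m to w, and pairing with θ_m takes the m-th component. The right
side no longer involves θ. -/
lemma metric_ricciEndo (u w : Model n) : B y (ricciEndo Γ θ y u) w = ricciForm Γ y u w := by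
  simp only [ricciEndo_apply, map_sum, _root_.sum_apply, ricciForm]
  refine Finset.sum_congr rfl fun m _ => ?_
  have := h.curv_skew hy u (stdVec m) (θ m y) w
  rw [h.metric_dual m y hy] at this
  rw [curv_antisymm Γ y (stdVec m)]
  simp
  linarith

/-- The families e_i and θ_i are dual for `B`, so the trace can be computed through the metric
without an orthonormal frame. -/
lemma sum_metric_dual (A : Model n →L[ℝ] Model n) :
    ∑ i, B y (stdVec i) (A (θ i y)) = ∑ i, A (stdVec i) i := by
  have h1 (i k : Fin n) : θ i y k = θ k y i := by
    rw [← h.metric_dual k y hy, h.metric_symm y hy, h.metric_dual i y hy]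
  have h2 (i : Fin n) : B y (stdVec i) (A (θ i y))
      = ∑ k, θ i y k * B y (stdVec i) (A (stdVec k)) := by
    rw [← sum_apply_smul_map_stdVec A (θ i y)]
    simp
  have h3 (k : Fin n) : A (stdVec k) k = ∑ i, θ k y i * B y (stdVec i) (A (stdVec k)) := by
    rw [← h.metric_dual k y hy]
    conv_lhs => rw [← sum_smul_stdVec (θ k y)]
    simp
  simp only [h2, h3]
  rw [Finset.sum_comm]
  simp only [h1]

/-- A linear map and its adjoint have the same trace. -/
lemma trace_adjoint {A C : Model n →L[ℝ] Model n} (hAC : ∀ a b, B y (A a) b = B y a (C b)) :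
    ∑ i, A (stdVec i) i = ∑ i, C (stdVec i) i := by
  rw [← h.sum_metric_dual hy C]
  refine Finset.sum_congr rfl fun i _ => ?_
  rw [← hAC, h.metric_symm y hy, h.metric_dual i y hy]

/-- The adjoint of Ω(u, v) is its negative, and adjoint maps have equal traces. -/
lemma curv_trace (u v : Model n) : ∑ i, curv Γ y u v (stdVec i) i = 0 := by
  have := h.trace_adjoint hy (A := curv Γ y u v) (C := - curv Γ y u v) fun a b => by
    have := h.curv_skew hy u v a b
    simp
    linarith
  simp only [_root_.neg_apply, PiLp.neg_apply, Finset.sum_neg_distrib] at this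
  linarith

/-- Trace the first Bianchi identity; the term tr Ω(u, v) vanishes. -/
lemma ricciForm_symm (u v : Model n) : ricciForm Γ y u v = ricciForm Γ y v u := by
  have h1 (i : Fin n) := congrArg (fun w : Model n => w i) (h.curv_cyclic hy (stdVec i) u v)
  have h2 : ∑ i, (curv Γ y (stdVec i) u v i + curv Γ y u v (stdVec i) i
      + curv Γ y v (stdVec i) u i) = 0 := by
    apply Finset.sum_eq_zero
    intro i _
    simpa using h1 i
  simp only [Finset.sum_add_distrib, h.curv_trace hy, curv_antisymm Γ y v, PiLp.neg_apply,
    Finset.sum_neg_distrib] at h2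
  unfold ricciForm
  linarith

end IsLeviCivitaOn

end

/-! ### Divergence of Ric(V) - (R/2) V for a conformal field. -/

section

variable {n : ℕ} {B : Model n → Model n →L[ℝ] Model n →L[ℝ] ℝ}
  {Γ : Model n → Model n →L[ℝ] Model n →L[ℝ] Model n} {θ : Fin n → Model n → Model n}
  {U : Set (Model n)}

/-- The covariant derivative `u ↦ ∇_u V`. -/
def covDeriv (Γ : Model n → Model n →L[ℝ] Model n →L[ℝ] Model n) (V : Model n → Model n)
    (y : Model n) : Model n →L[ℝ] Model n :=
  fderiv ℝ V y + (Γ y).flip (V y)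

lemma covDeriv_apply (V : Model n → Model n) (y u : Model n) :
    covDeriv Γ V y u = fderiv ℝ V y u + Γ y u (V y) := rfl

/-- The vector field `Ric(V) - (R / 2) V` obtained from `V` by the Einstein tensor. -/
def einsteinField (Γ : Model n → Model n →L[ℝ] Model n →L[ℝ] Model n)
    (θ : Fin n → Model n → Model n) (V : Model n → Model n) (y : Model n) : Model n :=
  ricciEndo Γ θ y (V y) - (1 / 2 * scalarTrace Γ θ y) • V y

namespace IsLeviCivitaOn

variable (h : IsLeviCivitaOn B Γ θ U) {y : Model n} (hy : y ∈ U)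
include h hy

lemma contDiffAt_scalarTrace : ContDiffAt ℝ ∞ (scalarTrace Γ θ) y := by
  apply ContDiffAt.sum
  intro i _
  exact (EuclideanSpace.proj i : Model n →L[ℝ] ℝ).contDiff.contDiffAt.comp y
    ((h.contDiffAt_ricciEndo hy).clm_apply contDiffAt_const)

lemma contDiffAt_einsteinField {V : Model n → Model n} (hV : ContDiffAt ℝ ∞ V y) :
    ContDiffAt ℝ ∞ (einsteinField Γ θ V) y :=
  ((h.contDiffAt_ricciEndo hy).clm_apply hV).sub
    ((contDiffAt_const.mul (h.contDiffAt_scalarTrace hy)).smul hV)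

lemma metric_ricciEndo_symm (u w : Model n) :
    B y (ricciEndo Γ θ y u) w = B y u (ricciEndo Γ θ y w) := by
  rw [h.metric_symm y hy u, h.metric_ricciEndo hy, h.metric_ricciEndo hy, h.ricciForm_symm hy]

/-- If `V` is a conformal field, then the divergence of `Ric(V) - (R / 2) V` is
`(1 - n / 2) φ R`. -/
lemma divergence_einsteinField {V : Model n → Model n} (hV : ContDiffAt ℝ ∞ V y) {φ : ℝ}
    (hφ : ∀ u w, B y (covDeriv Γ V y u) w + B y u (covDeriv Γ V y w) = 2 * φ * B y u w) :
    ∑ i, covDeriv Γ (einsteinField Γ θ V) y (stdVec i) i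
      = (1 - n / 2) * φ * scalarTrace Γ θ y := by
  have hVd : DifferentiableAt ℝ V y := hV.differentiableAt (by simp)
  have hs : DifferentiableAt ℝ (scalarTrace Γ θ) y :=
    (h.contDiffAt_scalarTrace hy).differentiableAt (by simp)
  have hρ := h.diff_ricciEndo hy
  set ρ := ricciEndo Γ θ y with hρdef
  set A := covDeriv Γ V y with hA
  -- The conformal equation says that the adjoint of A is 2φ - A; taking traces gives tr A = nφ.
  have htrA : ∑ i, A (stdVec i) i = n * φ := by
    have := h.trace_adjoint hy (A := A) (C := (2 * φ) • ContinuousLinearMap.id ℝ (Model n) - A)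
      fun a b => by
        have := hφ a b
        simp
        linarith
    simp at this
    linarith
  -- As ρ is self-adjoint, ρA has adjoint (2φ - A)ρ; taking traces and tr(Aρ) = tr(ρA) gives φR.
  have htrρA : ∑ i, ρ (A (stdVec i)) i = φ * scalarTrace Γ θ y := by
    have := h.trace_adjoint hy (A := ρ.comp A)
      (C := ((2 * φ) • ContinuousLinearMap.id ℝ (Model n) - A).comp ρ) fun a b => by
        have := hφ a (ρ b)
        simp only [ContinuousLinearMap.comp_apply]
        rw [h.metric_ricciEndo_symm hy]
        simp
        linarith
    have e := sum_comp_comm ρ A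
    simp [Finset.sum_sub_distrib, ← Finset.mul_sum] at this
    unfold scalarTrace
    linarith
  have hD (t : Model n) : fderiv ℝ (einsteinField Γ θ V) y t
      = fderiv ℝ (ricciEndo Γ θ) y t (V y) + ρ (fderiv ℝ V y t)
        - ((1 / 2 * fderiv ℝ (scalarTrace Γ θ) y t) • V y
          + (1 / 2 * scalarTrace Γ θ y) • fderiv ℝ V y t) := by
    have : HasFDerivAt (einsteinField Γ θ V) _ y :=
      (hρ.hasFDerivAt.clm_apply hVd.hasFDerivAt).sub
        ((hs.hasFDerivAt.const_mul (1 / 2)).smul hVd.hasFDerivAt)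
    rw [this.fderiv]
    simp
    abel
  have hb := h.fderiv_scalarTrace hy (V y)
  have hdv : fderiv ℝ (scalarTrace Γ θ) y (V y)
      = ∑ i, fderiv ℝ (scalarTrace Γ θ) y (stdVec i) * V y i := by
    rw [← sum_apply_smul_map_stdVec (fderiv ℝ (scalarTrace Γ θ) y) (V y)]
    simp [mul_comm]
  have hW : einsteinField Γ θ V y = ρ (V y) - (1 / 2 * scalarTrace Γ θ y) • V y := rfl
  simp only [hA, covDeriv_apply, map_add, PiLp.add_apply, Finset.sum_add_distrib] at htrA htrρA
  simp only [PiLp.add_apply, PiLp.sub_apply, Finset.sum_add_distrib, Finset.sum_sub_distrib] at hb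
  simp only [covDeriv_apply, hD, hW, map_sub, map_smul, PiLp.add_apply, PiLp.sub_apply,
    PiLp.smul_apply, smul_eq_mul, Finset.sum_add_distrib, Finset.sum_sub_distrib, mul_assoc,
    ← Finset.mul_sum]
  simp only [← hρdef] at hb
  rw [← hdv]
  -- The Bianchi term div(Ric) V = (1/2) V R cancels the derivative of -R/2; what is left is φR -
  -- (R/2) nφ.
  linear_combination htrρA - 1 / 2 * scalarTrace Γ θ y * htrA - 1 / 2 * hb

end IsLeviCivitaOn

/-! ### From a matrix of metric components to its Levi-Civita connection. -/

section Coordinates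

/-- The bilinear map with components `a i j`. -/
def bilin {F : Type*} [NormedAddCommGroup F] [NormedSpace ℝ F] (a : Fin n → Fin n → F) :
    Model n →L[ℝ] Model n →L[ℝ] F :=
  ∑ i, ∑ j, (EuclideanSpace.proj i : Model n →L[ℝ] ℝ).smulRight
    ((EuclideanSpace.proj j : Model n →L[ℝ] ℝ).smulRight (a i j))

section
variable {F : Type*} [NormedAddCommGroup F] [NormedSpace ℝ F]

lemma bilin_apply (a : Fin n → Fin n → F) (u v : Model n) :
    bilin a u v = ∑ i, ∑ j, u i • v j • a i j := by
  simp [bilin]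

lemma bilin_stdVec (a : Fin n → Fin n → F) (i j : Fin n) :
    bilin a (stdVec i) (stdVec j) = a i j := by
  simp [bilin_apply]

lemma contDiffAt_bilin {a : Model n → Fin n → Fin n → F} {y : Model n} {m : WithTop ℕ∞}
    (ha : ∀ i j, ContDiffAt ℝ m (fun z => a z i j) y) :
    ContDiffAt ℝ m (fun z => bilin (a z)) y := by
  apply ContDiffAt.sum
  intro i _
  apply ContDiffAt.sum
  intro j _
  exact (ContinuousLinearMap.smulRightL ℝ (Model n) (Model n →L[ℝ] F)
    (EuclideanSpace.proj i)).contDiff.contDiffAt.comp y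
    ((ContinuousLinearMap.smulRightL ℝ (Model n) F
      (EuclideanSpace.proj j)).contDiff.contDiffAt.comp y (ha i j))

end

/-- `G` is the matrix of the components of a smooth metric on the open set `U`. -/
structure IsMetricOn (G : Model n → Matrix (Fin n) (Fin n) ℝ) (U : Set (Model n)) : Prop where
  isOpen : IsOpen U
  smooth : ∀ i j, ∀ y ∈ U, ContDiffAt ℝ ∞ (fun z => G z i j) y
  symm : ∀ y ∈ U, ∀ i j, G y i j = G y j i
  det_pos : ∀ y ∈ U, 0 < (G y).det

/-- The metric with components `G`. -/
def metricForm (G : Model n → Matrix (Fin n) (Fin n) ℝ) (y : Model n) :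
    Model n →L[ℝ] Model n →L[ℝ] ℝ :=
  bilin fun i j => G y i j

/-- The Christoffel symbols as a bilinear map. -/
def connForm (G : Model n → Matrix (Fin n) (Fin n) ℝ) (y : Model n) :
    Model n →L[ℝ] Model n →L[ℝ] Model n :=
  bilin fun i j => WithLp.toLp 2 fun k => christoffel G k i j y

/-- The vector field which is `g`-dual to the `m`-th coordinate. -/
def dualVec (G : Model n → Matrix (Fin n) (Fin n) ℝ) (m : Fin n) (y : Model n) : Model n :=
  WithLp.toLp 2 fun k => (G y)⁻¹ k m

lemma contDiffAt_det {ι : Type*} [Fintype ι] [DecidableEq ι] {G : Model n → Matrix ι ι ℝ}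
    {y : Model n}
    (h : ∀ i j, ContDiffAt ℝ ∞ (fun z => G z i j) y) : ContDiffAt ℝ ∞ (fun z => (G z).det) y := by
  simp only [Matrix.det_apply']
  apply ContDiffAt.sum
  intro σ _
  exact contDiffAt_const.mul (contDiffAt_prod fun i _ => h _ _)

/-- Cramer's rule: each adjugate entry is the determinant of `G` with one row replaced by a constant
unit vector. -/
lemma contDiffAt_inv {G : Model n → Matrix (Fin n) (Fin n) ℝ} {y : Model n}
    (h : ∀ i j, ContDiffAt ℝ ∞ (fun z => G z i j) y) (h0 : (G y).det ≠ 0) (i j : Fin n) :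
    ContDiffAt ℝ ∞ (fun z => (G z)⁻¹ i j) y := by
  simp only [Matrix.inv_def, Matrix.smul_apply, Ring.inverse_eq_inv', smul_eq_mul,
    Matrix.adjugate_apply]
  refine ((contDiffAt_det h).inv h0).mul (contDiffAt_det fun k l => ?_)
  by_cases hk : k = j
  · subst hk; simpa using contDiffAt_const
  · simpa [Matrix.updateRow_ne hk] using h k l

namespace IsMetricOn

variable {G : Model n → Matrix (Fin n) (Fin n) ℝ} (h : IsMetricOn G U)
  {y : Model n} (hy : y ∈ U)
include h hy

lemma contDiffAt_partialDeriv (l i j : Fin n) :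
    ContDiffAt ℝ ∞ (partialDeriv l (fun z => G z i j)) y :=
  (contDiffAt_fderiv_top (h.smooth i j y hy)).clm_apply contDiffAt_const

lemma contDiffAt_christoffel (k i j : Fin n) : ContDiffAt ℝ ∞ (christoffel G k i j) y := by
  apply ContDiffAt.mul contDiffAt_const
  apply ContDiffAt.sum
  intro l _
  exact (contDiffAt_inv (fun i j => h.smooth i j y hy) (h.det_pos y hy).ne' k l).mul
    (((h.contDiffAt_partialDeriv hy _ _ _).add (h.contDiffAt_partialDeriv hy _ _ _)).sub
      (h.contDiffAt_partialDeriv hy _ _ _))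

lemma contDiffAt_metricForm : ContDiffAt ℝ ∞ (metricForm G) y :=
  contDiffAt_bilin fun i j => h.smooth i j y hy

lemma partialDeriv_eq (l i j : Fin n) : partialDeriv l (fun z => G z i j) y
    = fderiv ℝ (metricForm G) y (stdVec l) (stdVec i) (stdVec j) := by
  rw [← fderiv_clm_const_apply_apply ((h.contDiffAt_metricForm hy).differentiableAt (by simp))]
  simp [metricForm, bilin_stdVec, partialDeriv]

lemma metricForm_symm (u v : Model n) : metricForm G y u v = metricForm G y v u := by
  simp only [metricForm, bilin_apply]
  rw [Finset.sum_comm]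
  simp only [h.symm y hy, smul_eq_mul]
  refine Finset.sum_congr rfl fun i _ => Finset.sum_congr rfl fun j _ => ?_
  rw [h.symm y hy]
  ring

lemma fderiv_metricForm_symm (t u v : Model n) :
    fderiv ℝ (metricForm G) y t u v = fderiv ℝ (metricForm G) y t v u := by
  have hd := (h.contDiffAt_metricForm hy).differentiableAt (by simp)
  rw [← fderiv_clm_const_apply_apply hd, ← fderiv_clm_const_apply_apply hd]
  congr 1
  apply Filter.EventuallyEq.fderiv_eq
  filter_upwards [h.isOpen.mem_nhds hy] with z hz using h.metricForm_symm hz u v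

lemma metricForm_dualVec (m : Fin n) (v : Model n) :
    metricForm G y (dualVec G m y) v = v m := by
  rw [h.metricForm_symm hy]
  simp only [metricForm, bilin_apply, dualVec]
  have (i : Fin n) : ∑ j, v i • (G y)⁻¹ j m • G y i j = v i * (1 : Matrix _ _ ℝ) i m := by
    rw [← Matrix.mul_nonsing_inv (G y) (h.det_pos y hy).ne'.isUnit, Matrix.mul_apply,
      Finset.mul_sum]
    simp [mul_comm]
  simp only [this]
  simp [Matrix.one_apply]

/-- The Christoffel symbol is a combination of the fields `dualVec G m`, so pairing with e_l removes
the inverse matrix. -/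
lemma metricForm_christoffel (i j l : Fin n) :
    metricForm G y (connForm G y (stdVec i) (stdVec j)) (stdVec l)
      = 1 / 2 * (fderiv ℝ (metricForm G) y (stdVec i) (stdVec j) (stdVec l)
        + fderiv ℝ (metricForm G) y (stdVec j) (stdVec i) (stdVec l)
        - fderiv ℝ (metricForm G) y (stdVec l) (stdVec i) (stdVec j)) := by
  have e : connForm G y (stdVec i) (stdVec j)
      = ∑ m, (1 / 2 * (fderiv ℝ (metricForm G) y (stdVec i) (stdVec j) (stdVec m)
        + fderiv ℝ (metricForm G) y (stdVec j) (stdVec i) (stdVec m)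
        - fderiv ℝ (metricForm G) y (stdVec m) (stdVec i) (stdVec j))) • dualVec G m y := by
    ext k
    simp only [connForm, bilin_stdVec, christoffel, h.partialDeriv_eq hy, Finset.mul_sum,
      WithLp.ofLp_sum, Finset.sum_apply, PiLp.smul_apply, dualVec, smul_eq_mul]
    exact Finset.sum_congr rfl fun m _ => by ring
  rw [e]
  simp [h.metricForm_dualVec hy]

omit h hy in
lemma sum_trilinear (D : Model n →L[ℝ] Model n →L[ℝ] Model n →L[ℝ] ℝ) (t u v : Model n) :
    D t u v = ∑ i, ∑ j, ∑ l, t i * (u j * (v l * D (stdVec i) (stdVec j) (stdVec l))) := by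
  rw [← sum_apply_smul_map_stdVec D t]
  simp only [_root_.sum_apply, _root_.smul_apply, smul_eq_mul]
  refine Finset.sum_congr rfl fun i _ => ?_
  rw [← sum_apply_smul_map_stdVec (D (stdVec i)) u]
  simp only [_root_.sum_apply, _root_.smul_apply, smul_eq_mul, Finset.mul_sum]
  refine Finset.sum_congr rfl fun j _ => ?_
  rw [← sum_apply_smul_map_stdVec (D (stdVec i) (stdVec j)) v]
  simp only [smul_eq_mul, Finset.mul_sum]

/-- The Koszul formula. -/
lemma metricForm_connForm (t u v : Model n) : metricForm G y (connForm G y t u) v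
    = 1 / 2 * (fderiv ℝ (metricForm G) y t u v + fderiv ℝ (metricForm G) y u t v
        - fderiv ℝ (metricForm G) y v t u) := by
  have h1 := sum_trilinear ((ContinuousLinearMap.compL ℝ (Model n) (Model n)
    (Model n →L[ℝ] ℝ) (metricForm G y)).comp (connForm G y)) t u v
  simp only [ContinuousLinearMap.comp_apply, ContinuousLinearMap.compL_apply,
    h.metricForm_christoffel hy] at h1
  rw [h1, sum_trilinear (fderiv ℝ (metricForm G) y) t u v,
    sum_trilinear (fderiv ℝ (metricForm G) y) u t v,
    sum_trilinear (fderiv ℝ (metricForm G) y) v t u]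
  -- Rename indices so that all three sums carry the coefficient t_i u_j v_l.
  have e1 : ∑ i, ∑ j, ∑ l, u i * (t j * (v l *
        fderiv ℝ (metricForm G) y (stdVec i) (stdVec j) (stdVec l)))
      = ∑ i, ∑ j, ∑ l, t i * (u j * (v l *
        fderiv ℝ (metricForm G) y (stdVec j) (stdVec i) (stdVec l))) := by
    rw [Finset.sum_comm]
    refine Finset.sum_congr rfl fun i _ => Finset.sum_congr rfl fun j _ =>
      Finset.sum_congr rfl fun l _ => by ring
  have e2 : ∑ i, ∑ j, ∑ l, v i * (t j * (u l *
        fderiv ℝ (metricForm G) y (stdVec i) (stdVec j) (stdVec l)))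
      = ∑ i, ∑ j, ∑ l, t i * (u j * (v l *
        fderiv ℝ (metricForm G) y (stdVec l) (stdVec i) (stdVec j))) := by
    rw [Finset.sum_comm]
    refine Finset.sum_congr rfl fun i _ => ?_
    rw [Finset.sum_comm]
    refine Finset.sum_congr rfl fun j _ => Finset.sum_congr rfl fun l _ => by ring
  rw [e1, e2]
  simp only [← Finset.sum_add_distrib, ← Finset.sum_sub_distrib, Finset.mul_sum]
  refine Finset.sum_congr rfl fun i _ => Finset.sum_congr rfl fun j _ =>
    Finset.sum_congr rfl fun l _ => by ring

end IsMetricOn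

/-- Both axioms on the connection are read off from the Koszul formula: it is symmetric in (t, u),
and adding it to itself with u and v exchanged leaves the derivative of the metric. -/
lemma IsMetricOn.isLeviCivitaOn {G : Model n → Matrix (Fin n) (Fin n) ℝ} (h : IsMetricOn G U) :
    IsLeviCivitaOn (metricForm G) (connForm G) (dualVec G) U where
  isOpen := h.isOpen
  smooth_metric y hy := h.contDiffAt_metricForm hy
  smooth_conn y hy := by
    apply contDiffAt_bilin
    intro i j
    rw [contDiffAt_piLp]
    exact fun k => h.contDiffAt_christoffel hy k i j
  smooth_dual m y hy := by
    rw [contDiffAt_piLp]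
    exact fun k => contDiffAt_inv (fun i j => h.smooth i j y hy) (h.det_pos y hy).ne' k m
  metric_symm y hy := h.metricForm_symm hy
  conn_symm y hy u v := by
    ext m
    rw [← h.metricForm_dualVec hy, ← h.metricForm_dualVec hy, h.metricForm_symm hy,
      h.metricForm_symm hy _ (connForm G y v u), h.metricForm_connForm hy,
      h.metricForm_connForm hy, h.fderiv_metricForm_symm hy _ v u]
    ring
  compat y hy t u v := by
    rw [h.metricForm_symm hy u, h.metricForm_connForm hy, h.metricForm_connForm hy,
      h.fderiv_metricForm_symm hy t v u]
    ring
  metric_dual m y hy := h.metricForm_dualVec hy m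

end Coordinates

end

/-! ### Riemannian density, coordinate divergence, and the index formulas of the statement. -/

section

variable {n : ℕ} {U : Set (Model n)}

/-- Jacobi's formula: the determinant is multilinear in the rows, and replacing one row gives a
cofactor expansion. -/
lemma hasFDerivAt_det {ι : Type*} [Fintype ι] [DecidableEq ι] {E : Type*} [NormedAddCommGroup E]
    [NormedSpace ℝ E] {G : E → Matrix ι ι ℝ} {y : E} {G' : E →L[ℝ] (ι → ι → ℝ)}
    (h : HasFDerivAt (fun z => (G z : ι → ι → ℝ)) G' y) :
    ∃ D : E →L[ℝ] ℝ, HasFDerivAt (fun z => (G z).det) D y ∧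
      ∀ t, D t = ∑ i, ∑ j, G' t i j * (G y).adjugate j i := by
  let Δ : ContinuousMultilinearMap ℝ (fun _ : ι => ι → ℝ) ℝ :=
    { toMultilinearMap := (Matrix.detRowAlternating (R := ℝ) (n := ι)).toMultilinearMap
      cont := by
        change Continuous fun A : Matrix ι ι ℝ => A.det
        fun_prop }
  refine ⟨_, (Δ.hasFDerivAt (G y)).comp y h, fun t => ?_⟩
  refine (ContinuousMultilinearMap.linearDeriv_apply Δ (fun i => G y i) (G' t)).trans ?_
  refine Finset.sum_congr rfl fun i _ => ?_
  change ((G y).updateRow i (G' t i)).det = _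
  rw [← Matrix.cramer_transpose_apply, Matrix.cramer_eq_adjugate_mulVec, ← Matrix.adjugate_transpose]
  simp [Matrix.mulVec, dotProduct, mul_comm]

namespace IsMetricOn

variable {G : Model n → Matrix (Fin n) (Fin n) ℝ} (h : IsMetricOn G U)
  {y : Model n} (hy : y ∈ U)
include h hy

lemma diff_connForm : DifferentiableAt ℝ (connForm G) y := h.isLeviCivitaOn.diff_conn hy

lemma contDiffAt_sqrt_det : ContDiffAt ℝ ∞ (fun z => √(G z).det) y :=
  (contDiffAt_det fun i j => h.smooth i j y hy).sqrt (h.det_pos y hy).ne'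

/-- In Jacobi's formula insert ∂_t g_ij = ⟨Γ_t e_i, e_j⟩ + ⟨e_i, Γ_t e_j⟩; each half contributes det
G · tr Γ_t. -/
lemma fderiv_det (t : Model n) : fderiv ℝ (fun z => (G z).det) y t
    = 2 * (G y).det * ∑ i, connForm G y t (stdVec i) i := by
  have hLC := h.isLeviCivitaOn
  have hG : HasFDerivAt (fun z => (G z : Fin n → Fin n → ℝ))
      (ContinuousLinearMap.pi fun i => ContinuousLinearMap.pi fun j =>
        fderiv ℝ (fun z => G z i j) y) y :=
    hasFDerivAt_pi.2 fun i => hasFDerivAt_pi.2 fun j =>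
      ((h.smooth i j y hy).differentiableAt (by simp)).hasFDerivAt
  obtain ⟨D, hD, hDt⟩ := hasFDerivAt_det hG
  have hadj (i j : Fin n) : (G y).adjugate i j = (G y).det * dualVec G j y i := by
    simp only [dualVec, Matrix.inv_def, Matrix.smul_apply, Ring.inverse_eq_inv', smul_eq_mul]
    rw [mul_inv_cancel_left₀ (h.det_pos y hy).ne']
  have hGt (i j : Fin n) : fderiv ℝ (fun z => G z i j) y t
      = metricForm G y (connForm G y t (stdVec i)) (stdVec j)
        + metricForm G y (stdVec i) (connForm G y t (stdVec j)) := by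
    rw [← hLC.compat y hy, ← fderiv_clm_const_apply_apply (hLC.diff_metric hy)]
    simp [metricForm, bilin_stdVec]
  have hθ (i j : Fin n) : dualVec G j y i = dualVec G i y j := by
    rw [← h.metricForm_dualVec hy, h.metricForm_symm hy, h.metricForm_dualVec hy]
  rw [hD.fderiv, hDt]
  simp only [ContinuousLinearMap.coe_pi', hGt, hadj]
  have e1 : ∑ i, ∑ j, metricForm G y (connForm G y t (stdVec i)) (stdVec j) * dualVec G i y j
      = ∑ i, connForm G y t (stdVec i) i := by
    refine Finset.sum_congr rfl fun i _ => ?_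
    rw [← h.metricForm_dualVec hy i, h.metricForm_symm hy,
      ← sum_apply_smul_map_stdVec (metricForm G y (connForm G y t (stdVec i)))]
    simp [mul_comm]
  have e2 : ∑ i, ∑ j, metricForm G y (stdVec i) (connForm G y t (stdVec j)) * dualVec G i y j
      = ∑ i, connForm G y t (stdVec i) i := by
    rw [← hLC.sum_metric_dual hy]
    refine Finset.sum_congr rfl fun i _ => ?_
    rw [← sum_apply_smul_map_stdVec (connForm G y t) (dualVec G i y)]
    simp [mul_comm]
  have e3 (i j : Fin n) (a b : ℝ) : (a + b) * ((G y).det * dualVec G i y j)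
      = (G y).det * (a * dualVec G i y j) + (G y).det * (b * dualVec G i y j) := by ring
  simp only [e3, Finset.sum_add_distrib, ← Finset.mul_sum, e1, e2]
  ring

lemma fderiv_sqrt_det (t : Model n) : fderiv ℝ (fun z => √(G z).det) y t
    = √(G y).det * ∑ i, connForm G y t (stdVec i) i := by
  have hd : DifferentiableAt ℝ (fun z => (G z).det) y :=
    (contDiffAt_det fun i j => h.smooth i j y hy).differentiableAt (by simp)
  have h0 := Real.sqrt_pos.2 (h.det_pos y hy)
  rw [fderiv_sqrt hd (h.det_pos y hy).ne', _root_.smul_apply, h.fderiv_det hy, smul_eq_mul]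
  have := Real.mul_self_sqrt (h.det_pos y hy).le
  field_simp
  rw [sq, this]

/-- The divergence of a vector field in coordinates. -/
lemma sum_partialDeriv_sqrt_det_mul {W : Model n → Model n} (hW : DifferentiableAt ℝ W y) :
    ∑ i, partialDeriv i (fun z => √(G z).det * W z i) y
      = √(G y).det * ∑ i, covDeriv (connForm G) W y (stdVec i) i := by
  have hLC := h.isLeviCivitaOn
  have hs := (h.contDiffAt_sqrt_det hy).differentiableAt (by simp)
  have e (i : Fin n) : partialDeriv i (fun z => √(G z).det * W z i) y
      = √(G y).det * fderiv ℝ W y (stdVec i) i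
        + W y i * (√(G y).det * ∑ j, connForm G y (stdVec i) (stdVec j) j) := by
    have hWi : HasFDerivAt (fun z => W z i)
        ((EuclideanSpace.proj i : Model n →L[ℝ] ℝ).comp (fderiv ℝ W y)) y :=
      (EuclideanSpace.proj i : Model n →L[ℝ] ℝ).hasFDerivAt.comp y hW.hasFDerivAt
    rw [partialDeriv, (hs.hasFDerivAt.fun_mul hWi).fderiv]
    simp [h.fderiv_sqrt_det hy]
  -- The density contributes tr Γ_W; torsion-freeness turns it into the trace of u ↦ Γ_u W, the
  -- correction term in ∇W.
  have e2 : ∑ i, W y i * ∑ j, connForm G y (stdVec i) (stdVec j) j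
      = ∑ i, connForm G y (stdVec i) (W y) i := by
    simp only [Finset.mul_sum]
    rw [Finset.sum_comm]
    refine Finset.sum_congr rfl fun j _ => ?_
    rw [hLC.conn_symm y hy, ← sum_apply_smul_map_stdVec (connForm G y) (W y)]
    simp
  simp only [e, covDeriv_apply, PiLp.add_apply, Finset.sum_add_distrib, ← e2, mul_add,
    Finset.mul_sum]
  congr 1
  refine Finset.sum_congr rfl fun i _ => Finset.sum_congr rfl fun j _ => by ring

omit h hy in
lemma connForm_apply_apply (i : Fin n) (v : Model n) (l : Fin n) :
    connForm G y (stdVec i) v l = ∑ m, christoffel G l i m y * v m := by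
  rw [← sum_apply_smul_map_stdVec (connForm G y (stdVec i)) v]
  simp [connForm, bilin_stdVec, mul_comm]

lemma riemann_eq (l k i j : Fin n) :
    riemann G l k i j y = curv (connForm G) y (stdVec i) (stdVec j) (stdVec k) l := by
  have hd := h.diff_connForm hy
  have e (i j k : Fin n) : partialDeriv i (christoffel G l j k) y
      = fderiv ℝ (connForm G) y (stdVec i) (stdVec j) (stdVec k) l := by
    have hk : HasFDerivAt (fun z => connForm G z (stdVec j) (stdVec k) l)
        ((EuclideanSpace.proj l : Model n →L[ℝ] ℝ).comp
          (fderiv ℝ (fun z => connForm G z (stdVec j) (stdVec k)) y)) y :=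
      (EuclideanSpace.proj l : Model n →L[ℝ] ℝ).hasFDerivAt.comp y
        ((hd.clm_apply (differentiableAt_const _)).clm_apply
          (differentiableAt_const _)).hasFDerivAt
    have hc : (fun z => connForm G z (stdVec j) (stdVec k) l) = christoffel G l j k := by
      funext z
      simp [connForm, bilin_stdVec]
    rw [← hc, partialDeriv, hk.fderiv, ContinuousLinearMap.comp_apply,
      fderiv_clm_const_apply_apply hd]
    rfl
  rw [riemann, e, e, curv_apply]
  simp only [PiLp.add_apply, PiLp.sub_apply, connForm_apply_apply, Finset.sum_sub_distrib]
  simp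

lemma ricci_eq (j k : Fin n) :
    ricci G j k y = ricciForm (connForm G) y (stdVec j) (stdVec k) := by
  simp [ricci, ricciForm, h.riemann_eq hy]

lemma scalarCoord_eq : scalarCoord G y = scalarTrace (connForm G) (dualVec G) y := by
  have hLC := h.isLeviCivitaOn
  have hθ (i j : Fin n) : (G y)⁻¹ i j = dualVec G i y j := by
    rw [← h.metricForm_dualVec hy j, h.metricForm_symm hy, h.metricForm_dualVec hy]
    rfl
  unfold scalarCoord scalarTrace
  refine Finset.sum_congr rfl fun j _ => ?_
  rw [← h.metricForm_dualVec hy j, h.metricForm_symm hy,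
    ← sum_apply_smul_map_stdVec (metricForm G y (ricciEndo _ _ y (stdVec j)))]
  refine Finset.sum_congr rfl fun k _ => ?_
  rw [hLC.metric_ricciEndo hy, h.ricci_eq hy, hθ, smul_eq_mul]

/-- Compatibility rewrites V g_ij with Γ_V e_i and Γ_V e_j; torsion-freeness makes these Γ_{e_i} V
and Γ_{e_j} V, completing ∂V to ∇V. -/
lemma lieDerivCoord_eq {V : Model n → Model n} (hV : DifferentiableAt ℝ V y) (i j : Fin n) :
    lieDerivCoord G V i j y
      = metricForm G y (covDeriv (connForm G) V y (stdVec i)) (stdVec j)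
        + metricForm G y (stdVec i) (covDeriv (connForm G) V y (stdVec j)) := by
  have hLC := h.isLeviCivitaOn
  have hB (k l : Fin n) : G y k l = metricForm G y (stdVec k) (stdVec l) := by
    simp [metricForm, bilin_stdVec]
  have hVd (i k : Fin n) : partialDeriv i (fun z => V z k) y = fderiv ℝ V y (stdVec i) k := by
    have hk : HasFDerivAt (fun z => V z k)
        ((EuclideanSpace.proj k : Model n →L[ℝ] ℝ).comp (fderiv ℝ V y)) y :=
      (EuclideanSpace.proj k : Model n →L[ℝ] ℝ).hasFDerivAt.comp y hV.hasFDerivAt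
    rw [partialDeriv, hk.fderiv]
    rfl
  have e1 : ∑ k, V y k * partialDeriv k (fun z => G z i j) y
      = fderiv ℝ (metricForm G) y (V y) (stdVec i) (stdVec j) := by
    simp only [h.partialDeriv_eq hy]
    rw [← sum_apply_smul_map_stdVec (fderiv ℝ (metricForm G) y) (V y)]
    simp
  have e2 : ∑ k, G y k j * partialDeriv i (fun z => V z k) y
      = metricForm G y (fderiv ℝ V y (stdVec i)) (stdVec j) := by
    rw [← sum_apply_smul_map_stdVec (metricForm G y) (fderiv ℝ V y (stdVec i))]
    simp [hVd, hB, mul_comm]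
  have e3 : ∑ k, G y i k * partialDeriv j (fun z => V z k) y
      = metricForm G y (stdVec i) (fderiv ℝ V y (stdVec j)) := by
    rw [← sum_apply_smul_map_stdVec (metricForm G y (stdVec i)) (fderiv ℝ V y (stdVec j))]
    simp [hVd, hB, mul_comm]
  simp only [lieDerivCoord, Finset.sum_add_distrib, e1, e2, e3, hLC.compat y hy, covDeriv_apply,
    map_add, _root_.add_apply]
  rw [hLC.conn_symm y hy (V y), hLC.conn_symm y hy (V y)]
  ring

omit h hy in
lemma bilinear_ext {P Q : Model n →L[ℝ] Model n →L[ℝ] ℝ}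
    (hPQ : ∀ i j, P (stdVec i) (stdVec j) = Q (stdVec i) (stdVec j)) : P = Q := by
  ext u w
  rw [← sum_apply_smul_map_stdVec P u, ← sum_apply_smul_map_stdVec Q u]
  simp only [_root_.sum_apply, _root_.smul_apply]
  refine Finset.sum_congr rfl fun i _ => ?_
  rw [← sum_apply_smul_map_stdVec (P (stdVec i)) w, ← sum_apply_smul_map_stdVec (Q (stdVec i)) w]
  simp [hPQ]

/-- If `£_V g = 2 φ g` at `y`, then the divergence of `Ric(V) - (R / 2) V` at `y` is
`(1 - n / 2) φ R`. -/
lemma sum_partialDeriv_einsteinField {V : Model n → Model n} (hV : ContDiffAt ℝ ∞ V y) {φ : ℝ}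
    (hφ : ∀ i j, lieDerivCoord G V i j y = 2 * φ * G y i j) :
    ∑ i, partialDeriv i
        (fun z => √(G z).det * einsteinField (connForm G) (dualVec G) V z i) y
      = √(G y).det * ((1 - n / 2) * φ * scalarCoord G y) := by
  have hLC := h.isLeviCivitaOn
  rw [h.sum_partialDeriv_sqrt_det_mul hy
    ((hLC.contDiffAt_einsteinField hy hV).differentiableAt (by simp)),
    hLC.divergence_einsteinField hy hV (φ := φ), h.scalarCoord_eq hy]
  -- The hypothesis concerns basis vectors only; as an equality of bilinear maps it extends to all
  -- vectors.
  have key : (metricForm G y).comp (covDeriv (connForm G) V y)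
      + (((metricForm G y).flip).comp (covDeriv (connForm G) V y)).flip
      = (2 * φ) • metricForm G y := by
    apply bilinear_ext
    intro i j
    have := hφ i j
    rw [h.lieDerivCoord_eq hy (hV.differentiableAt (by simp))] at this
    simpa [metricForm, bilin_stdVec] using this
  intro u w
  simpa using DFunLike.congr_fun (DFunLike.congr_fun key u) w

end IsMetricOn

end

/-! ### Naturality under local isometries. -/

section

/-- `ψ` is a smooth local isometry from `(U, B)` to `(U', B')`. -/
structure IsIsometryOn {n : ℕ} (B B' : Model n → Model n →L[ℝ] Model n →L[ℝ] ℝ)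
    (ψ : Model n → Model n) (U U' : Set (Model n)) : Prop where
  mapsTo : Set.MapsTo ψ U U'
  smooth : ∀ y ∈ U, ContDiffAt ℝ ∞ ψ y
  pullback : ∀ y ∈ U, ∀ u v, B y u v = B' (ψ y) (fderiv ℝ ψ y u) (fderiv ℝ ψ y v)

variable {n : ℕ} {B B' : Model n → Model n →L[ℝ] Model n →L[ℝ] ℝ}
  {Γ Γ' : Model n → Model n →L[ℝ] Model n →L[ℝ] Model n} {θ θ' : Fin n → Model n → Model n}
  {ψ : Model n → Model n} {U U' : Set (Model n)}

namespace IsIsometryOn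

variable (hψ : IsIsometryOn B B' ψ U U') (h : IsLeviCivitaOn B Γ θ U)
  (h' : IsLeviCivitaOn B' Γ' θ' U') {y : Model n} (hy : y ∈ U)

include hψ hy

lemma diff : DifferentiableAt ℝ ψ y := (hψ.smooth y hy).differentiableAt (by simp)

lemma diff_fderiv : DifferentiableAt ℝ (fderiv ℝ ψ) y :=
  (contDiffAt_fderiv_top (hψ.smooth y hy)).differentiableAt (by simp)

include h

/-- The pulled-back form is nondegenerate, so the differential is injective, hence bijective in
finite dimension. -/
lemma exists_inverse : ∃ M : Model n →L[ℝ] Model n,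
    (∀ v, fderiv ℝ ψ y (M v) = v) ∧ ∀ v, M (fderiv ℝ ψ y v) = v := by
  have hinj : Function.Injective (fderiv ℝ ψ y : Model n →ₗ[ℝ] Model n) := by
    rw [← LinearMap.ker_eq_bot, LinearMap.ker_eq_bot']
    intro v hv
    apply h.metric_ext hy
    intro w
    have hv' : fderiv ℝ ψ y v = 0 := hv
    rw [hψ.pullback y hy, hv']
    simp
  let e := LinearEquiv.ofInjectiveEndo _ hinj
  exact ⟨LinearMap.toContinuousLinearMap (e.symm : Model n →ₗ[ℝ] Model n),
    fun v => e.apply_symm_apply v, fun v => e.symm_apply_apply v⟩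

lemma trace_eq {A C : Model n →L[ℝ] Model n}
    (hAC : ∀ v, fderiv ℝ ψ y (A v) = C (fderiv ℝ ψ y v)) :
    ∑ i, A (stdVec i) i = ∑ i, C (stdVec i) i := by
  obtain ⟨M, hM, hM'⟩ := hψ.exists_inverse h hy
  have := sum_comp_comm M ((fderiv ℝ ψ y).comp A)
  simp only [ContinuousLinearMap.comp_apply, hM'] at this
  simp only [hAC, hM] at this
  exact this

include h'

/-- Uniqueness of the Levi-Civita connection: the defect `X` is symmetric in its two arguments (no
torsion), while ⟨X(t, u), v⟩ is skew in u and v (compatibility). Cycling the three slots forces `X`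
to vanish. -/
lemma fderiv_apply_conn (t u : Model n) : fderiv ℝ ψ y (Γ y t u)
    = fderiv ℝ (fderiv ℝ ψ) y t u + Γ' (ψ y) (fderiv ℝ ψ y t) (fderiv ℝ ψ y u) := by
  have hy' := hψ.mapsTo hy
  have hd := hψ.diff hy
  have hd2 := hψ.diff_fderiv hy
  have hpe (u : Model n) : DifferentiableAt ℝ (fun z => fderiv ℝ ψ z u) y :=
    hd2.clm_apply (differentiableAt_const u)
  have hcomp : HasFDerivAt (fun z => B' (ψ z)) ((fderiv ℝ B' (ψ y)).comp (fderiv ℝ ψ y)) y :=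
    (h'.diff_metric hy').hasFDerivAt.comp y hd.hasFDerivAt
  let X (t u : Model n) : Model n := fderiv ℝ ψ y (Γ y t u)
    - (fderiv ℝ (fderiv ℝ ψ) y t u + Γ' (ψ y) (fderiv ℝ ψ y t) (fderiv ℝ ψ y u))
  have hX (t u : Model n) : X t u = X u t := by
    simp only [X]
    rw [h.conn_symm y hy t u, fderiv_fderiv_symm (hψ.smooth y hy) t u,
      h'.conn_symm _ hy' (fderiv ℝ ψ y t)]
  have hskew (t u v : Model n) : B' (ψ y) (X t u) (fderiv ℝ ψ y v)
      = - B' (ψ y) (X t v) (fderiv ℝ ψ y u) := by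
    have e : (fun z => B z u v) =ᶠ[nhds y]
        fun z => B' (ψ z) (fderiv ℝ ψ z u) (fderiv ℝ ψ z v) := by
      filter_upwards [h.mem_nhds hy] with z hz using hψ.pullback z hz u v
    have e2 := DFunLike.congr_fun (e.fderiv_eq (𝕜 := ℝ)) t
    rw [fderiv_clm_const_apply_apply (h.diff_metric hy), h.compat y hy,
      fderiv_clm_apply_apply hcomp.differentiableAt (hpe u) (hpe v), hcomp.fderiv,
      fderiv_clm_const_apply hd2, fderiv_clm_const_apply hd2, ContinuousLinearMap.comp_apply,
      h'.compat _ hy', hψ.pullback y hy, hψ.pullback y hy] at e2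
    rw [h'.metric_symm _ hy' (X t v)]
    simp only [X, map_sub, map_add, _root_.sub_apply, _root_.add_apply]
    linarith
  obtain ⟨M, hM, -⟩ := hψ.exists_inverse h hy
  have hzero : X t u = 0 := by
    apply h'.metric_ext hy'
    intro w
    rw [← hM w]
    have h1 := hskew t u (M w)
    have h2 := hskew u (M w) t
    have h3 := hskew (M w) t u
    rw [hX t (M w)] at h1
    rw [hX (M w) u] at h3
    rw [hX u t] at h2
    simp only [map_zero, _root_.zero_apply]
    linarith
  exact sub_eq_zero.1 hzero

/-- Differentiate the transformation law of Γ and antisymmetrize: the third derivatives of ψ drop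
out, and the second derivatives are eliminated by the law itself (c1 to c4). -/
lemma fderiv_apply_curv (t u v : Model n) : fderiv ℝ ψ y (curv Γ y t u v)
    = curv Γ' (ψ y) (fderiv ℝ ψ y t) (fderiv ℝ ψ y u) (fderiv ℝ ψ y v) := by
  have hy' := hψ.mapsTo hy
  have hd := hψ.diff hy
  have hd2 := hψ.diff_fderiv hy
  have hsm := contDiffAt_fderiv_top (hψ.smooth y hy)
  have hd3 : DifferentiableAt ℝ (fderiv ℝ (fderiv ℝ ψ)) y :=
    (contDiffAt_fderiv_top hsm).differentiableAt (by simp)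
  have hpe (u : Model n) : DifferentiableAt ℝ (fun z => fderiv ℝ ψ z u) y :=
    hd2.clm_apply (differentiableAt_const u)
  have hcomp : HasFDerivAt (fun z => Γ' (ψ z)) ((fderiv ℝ Γ' (ψ y)).comp (fderiv ℝ ψ y)) y :=
    (h'.diff_conn hy').hasFDerivAt.comp y hd.hasFDerivAt
  have hΓ (u v : Model n) : DifferentiableAt ℝ (fun z => Γ z u v) y :=
    ((h.diff_conn hy).clm_apply (differentiableAt_const u)).clm_apply (differentiableAt_const v)
  have key (t u : Model n) :
      fderiv ℝ (fderiv ℝ ψ) y t (Γ y u v) + fderiv ℝ ψ y (fderiv ℝ Γ y t u v)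
      = fderiv ℝ (fderiv ℝ (fderiv ℝ ψ)) y t u v
        + (fderiv ℝ Γ' (ψ y) (fderiv ℝ ψ y t) (fderiv ℝ ψ y u) (fderiv ℝ ψ y v)
          + Γ' (ψ y) (fderiv ℝ (fderiv ℝ ψ) y t u) (fderiv ℝ ψ y v)
          + Γ' (ψ y) (fderiv ℝ ψ y u) (fderiv ℝ (fderiv ℝ ψ) y t v)) := by
    have e : (fun z => fderiv ℝ ψ z (Γ z u v)) =ᶠ[nhds y]
        fun z => fderiv ℝ (fderiv ℝ ψ) z u v
          + Γ' (ψ z) (fderiv ℝ ψ z u) (fderiv ℝ ψ z v) := by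
      filter_upwards [h.mem_nhds hy] with z hz using hψ.fderiv_apply_conn h h' hz u v
    have e2 := DFunLike.congr_fun (e.fderiv_eq (𝕜 := ℝ)) t
    rw [(hd2.hasFDerivAt.clm_apply (hΓ u v).hasFDerivAt).fderiv, fderiv_fun_add] at e2
    simp only [_root_.add_apply] at e2
    rw [fderiv_clm_const_apply_apply hd3,
      fderiv_clm_apply_apply hcomp.differentiableAt (hpe u) (hpe v), hcomp.fderiv,
      fderiv_clm_const_apply hd2, fderiv_clm_const_apply hd2] at e2
    · simp only [ContinuousLinearMap.comp_apply,
        ContinuousLinearMap.flip_apply, fderiv_clm_const_apply_apply (h.diff_conn hy)] at e2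
      rw [← e2, add_comm]
    · exact (hd3.clm_apply (differentiableAt_const u)).clm_apply (differentiableAt_const v)
    · exact (hcomp.differentiableAt.clm_apply (hpe u)).clm_apply (hpe v)
  have k1 := key t u
  have k2 := key u t
  rw [fderiv_fderiv_symm hsm u t, fderiv_fderiv_symm (hψ.smooth y hy) u t] at k2
  have c := hψ.fderiv_apply_conn h h' hy
  have c1 := c t (Γ y u v)
  have c2 := c u (Γ y t v)
  have c3 := congrArg (Γ' (ψ y) (fderiv ℝ ψ y t)) (c u v)
  have c4 := congrArg (Γ' (ψ y) (fderiv ℝ ψ y u)) (c t v)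
  simp only [map_add] at c3 c4
  simp only [curv_apply, map_add, map_sub]
  linear_combination (norm := abel) k1 - k2 + c1 - c2 + c3 - c4

lemma ricciForm_eq (u v : Model n) : ricciForm Γ y u v
    = ricciForm Γ' (ψ y) (fderiv ℝ ψ y u) (fderiv ℝ ψ y v) :=
  hψ.trace_eq h hy (A := ((curv Γ y).flip u).flip v)
    (C := ((curv Γ' (ψ y)).flip (fderiv ℝ ψ y u)).flip (fderiv ℝ ψ y v))
    fun w => hψ.fderiv_apply_curv h h' hy w u v

/-- θ and θ' need not correspond under ψ: the endomorphism is determined by the Ricci form and the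
metric. -/
lemma fderiv_apply_ricciEndo (u : Model n) : fderiv ℝ ψ y (ricciEndo Γ θ y u)
    = ricciEndo Γ' θ' (ψ y) (fderiv ℝ ψ y u) := by
  obtain ⟨M, hM, -⟩ := hψ.exists_inverse h hy
  apply h'.metric_ext (hψ.mapsTo hy)
  intro w
  rw [← hM w, ← hψ.pullback y hy, h.metric_ricciEndo hy, h'.metric_ricciEndo (hψ.mapsTo hy),
    hψ.ricciForm_eq h h' hy]

lemma scalarTrace_eq : scalarTrace Γ θ y = scalarTrace Γ' θ' (ψ y) :=
  hψ.trace_eq h hy fun v => hψ.fderiv_apply_ricciEndo h h' hy v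

lemma einsteinField_eq {V V' : Model n → Model n} (hV : V' (ψ y) = fderiv ℝ ψ y (V y)) :
    einsteinField Γ' θ' V' (ψ y) = fderiv ℝ ψ y (einsteinField Γ θ V y) := by
  unfold einsteinField
  rw [map_sub, map_smul, hψ.fderiv_apply_ricciEndo h h' hy, hV, hψ.scalarTrace_eq h h' hy]

end IsIsometryOn

/-- G = Jᵀ G' J for the Jacobian matrix J of ψ. The factor |det J| is the one in the change of
variables formula. -/
lemma sqrt_det_eq_of_isometry {G G' : Model n → Matrix (Fin n) (Fin n) ℝ}
    (hψ : IsIsometryOn (metricForm G) (metricForm G') ψ U U') {y : Model n} (hy : y ∈ U) :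
    √(G y).det = |(fderiv ℝ ψ y).det| * √(G' (ψ y)).det := by
  let b := (EuclideanSpace.basisFun (Fin n) ℝ).toBasis
  let J := LinearMap.toMatrix b b (fderiv ℝ ψ y : Model n →ₗ[ℝ] Model n)
  have hJ (i j : Fin n) : J i j = fderiv ℝ ψ y (stdVec j) i := by
    simp [J, b, LinearMap.toMatrix_apply]
  have hG : G y = J.transpose * G' (ψ y) * J := by
    ext i j
    have e := hψ.pullback y hy (stdVec i) (stdVec j)
    simp only [metricForm, bilin_stdVec] at e
    rw [e, bilin_apply]
    simp only [Matrix.mul_apply, Matrix.transpose_apply, hJ, Finset.sum_mul, smul_eq_mul]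
    rw [Finset.sum_comm]
    refine Finset.sum_congr rfl fun k _ => Finset.sum_congr rfl fun l _ => by ring
  have hdet : J.det = (fderiv ℝ ψ y).det := LinearMap.det_toMatrix b _
  rw [hG, Matrix.det_mul, Matrix.det_mul, Matrix.det_transpose, hdet, mul_right_comm,
    Real.sqrt_mul (mul_self_nonneg _), Real.sqrt_mul_self_eq_abs]

end

/-! ### Charts of the manifold: smoothness of components and transition laws. -/

section

variable {n : ℕ} {M : Type*} [TopologicalSpace M] [ChartedSpace (Model n) M]
  [IsManifold (𝓡 n) ∞ M]

/-- Charts and their inverses are smooth only on open sets; there the derivative within the set is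
the full derivative, so the tangent map applies. -/
lemma contMDiffAt_tangentMap {M' : Type*} [TopologicalSpace M'] [ChartedSpace (Model n) M']
    [IsManifold (𝓡 n) ∞ M'] {f : M → M'} {s : Set M} (hs : IsOpen s)
    (hf : ContMDiffOn (𝓡 n) (𝓡 n) ∞ f s) {X : ∀ x : M, TangentSpace (𝓡 n) x} {x : M} (hx : x ∈ s)
    (hX : ContMDiffAt (𝓡 n) (𝓡 n).tangent ∞
      (fun x => (⟨x, X x⟩ : TangentBundle (𝓡 n) M)) x) :
    ContMDiffAt (𝓡 n) (𝓡 n).tangent ∞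
      (fun x => (⟨f x, mfderiv (𝓡 n) (𝓡 n) f x (X x)⟩ : TangentBundle (𝓡 n) M')) x := by
  have : IsManifold (𝓡 n) 1 M := IsManifold.of_le (n := ∞) (by simp)
  have : IsManifold (𝓡 n) 1 M' := IsManifold.of_le (n := ∞) (by simp)
  have h1 := hf.contMDiffOn_tangentMapWithin (m := ∞) (by simp) hs.uniqueMDiffOn
  have h2 : ContMDiffWithinAt (𝓡 n) (𝓡 n).tangent ∞
      (fun x => tangentMapWithin (𝓡 n) (𝓡 n) f s (⟨x, X x⟩ : TangentBundle (𝓡 n) M)) s x :=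
    ContMDiffWithinAt.comp x (h1 ⟨x, X x⟩ hx) hX.contMDiffWithinAt (fun z hz => hz)
  refine (h2.contMDiffAt (hs.mem_nhds hx)).congr_of_eventuallyEq ?_
  filter_upwards [hs.mem_nhds hx] with z hz
  simp [tangentMapWithin, mfderivWithin_of_isOpen hs hz]

variable {e e' : OpenPartialHomeomorph M (Model n)}

lemma contMDiffOn_of_mem_atlas (he : e ∈ atlas (Model n) M) :
    ContMDiffOn (𝓡 n) (𝓡 n) ∞ e e.source :=
  contMDiffOn_of_mem_maximalAtlas (IsManifold.subset_maximalAtlas he)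

lemma contMDiffOn_symm_of_mem_atlas (he : e ∈ atlas (Model n) M) :
    ContMDiffOn (𝓡 n) (𝓡 n) ∞ e.symm e.target :=
  contMDiffOn_symm_of_mem_maximalAtlas (IsManifold.subset_maximalAtlas he)

lemma mdifferentiable_of_mem_atlas' (he : e ∈ atlas (Model n) M) :
    e.MDifferentiable (𝓡 n) (𝓡 n) :=
  ⟨(contMDiffOn_of_mem_atlas he).mdifferentiableOn (by simp),
    (contMDiffOn_symm_of_mem_atlas he).mdifferentiableOn (by simp)⟩

lemma contMDiffAt_coordVec (he : e ∈ atlas (Model n) M) (i : Fin n) {y : Model n}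
    (hy : y ∈ e.target) : ContMDiffAt (𝓡 n) (𝓡 n).tangent ∞
      (fun y => (⟨e.symm y, coordVec e i y⟩ : TangentBundle (𝓡 n) M)) y := by
  refine contMDiffAt_tangentMap e.open_target (contMDiffOn_symm_of_mem_atlas he)
    (X := fun _ => (EuclideanSpace.single i (1 : ℝ) : Model n)) hy ?_
  exact contMDiffAt_vectorSpace_iff_contDiffAt.2 contDiffAt_const

lemma contDiffAt_gram (g : Metric n M) (he : e ∈ atlas (Model n) M) (i j : Fin n) {y : Model n}
    (hy : y ∈ e.target) : ContDiffAt ℝ ∞ (fun z => gram g e z i j) y := by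
  have hb : ContMDiffAt (𝓡 n) (𝓡 n) ∞ e.symm y :=
    (contMDiffOn_symm_of_mem_atlas he).contMDiffAt (e.open_target.mem_nhds hy)
  have h1 : ContMDiffAt (𝓡 n) ((𝓡 n).prod 𝓘(ℝ)) ∞
      (fun z => Bundle.TotalSpace.mk' ℝ (E := Bundle.Trivial M ℝ) (e.symm z)
        (g.inner (e.symm z) (coordVec e i z) (coordVec e j z))) y := by
    apply ContMDiffAt.clm_bundle_apply₂ (F₁ := Model n) (F₂ := Model n)
    · exact ContMDiffAt.comp y g.contMDiff.contMDiffAt hb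
    · exact contMDiffAt_coordVec he i hy
    · exact contMDiffAt_coordVec he j hy
  simp only [Bundle.contMDiffAt_totalSpace] at h1
  exact contMDiffAt_iff_contDiffAt.1 h1.2

lemma contDiffAt_vecCoord {V : ∀ x : M, TangentSpace (𝓡 n) x} (hV : IsSmoothVectorField V)
    (he : e ∈ atlas (Model n) M) {y : Model n} (hy : y ∈ e.target) :
    ContDiffAt ℝ ∞ (vecCoord V e) y := by
  have h1 := contMDiffAt_tangentMap e.open_source (contMDiffOn_of_mem_atlas he)
    (X := V) (e.map_target hy) hV.contMDiffAt
  have h2 : ContMDiffAt (𝓡 n) (𝓡 n).tangent ∞ (fun z => (⟨e (e.symm z),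
      mfderiv (𝓡 n) (𝓡 n) e (e.symm z) (V (e.symm z))⟩ : TangentBundle (𝓡 n) (Model n))) y :=
    ContMDiffAt.comp y h1
      ((contMDiffOn_symm_of_mem_atlas he).contMDiffAt (e.open_target.mem_nhds hy))
  exact contMDiffAt_iff_contDiffAt.1
    ((contMDiff_snd_tangentBundle_modelSpace (Model n) (𝓡 n)).contMDiffAt.comp y h2)

/-- The differential of the inverse of the chart `e`. -/
def symmDeriv (e : OpenPartialHomeomorph M (Model n)) (y : Model n) : Model n →L[ℝ] Model n :=
  mfderiv (𝓡 n) (𝓡 n) e.symm y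

/-- The differential of the chart `e`. -/
def chartDeriv (e : OpenPartialHomeomorph M (Model n)) (x : M) : Model n →L[ℝ] Model n :=
  mfderiv (𝓡 n) (𝓡 n) e x

/-- The metric at a point as a bilinear form on the model space. -/
def innerAt (g : Metric n M) (x : M) : Model n →L[ℝ] Model n →L[ℝ] ℝ := g.inner x

lemma innerAt_symm (g : Metric n M) (x : M) (u v : Model n) :
    innerAt g x u v = innerAt g x v u := g.symm x u v

lemma innerAt_pos (g : Metric n M) (x : M) {v : Model n} (hv : v ≠ 0) :
    0 < innerAt g x v v := g.pos x v hv

lemma gram_apply (g : Metric n M) (e : OpenPartialHomeomorph M (Model n)) (y : Model n)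
    (i j : Fin n) : gram g e y i j
      = innerAt g (e.symm y) (symmDeriv e y (stdVec i)) (symmDeriv e y (stdVec j)) := rfl

lemma symmDeriv_chartDeriv (he : e ∈ atlas (Model n) M) {x : M} (hx : x ∈ e.source)
    (v : Model n) : symmDeriv e (e x) (chartDeriv e x v) = v :=
  DFunLike.congr_fun ((mdifferentiable_of_mem_atlas' he).symm_comp_deriv hx) v

lemma chartDeriv_symmDeriv (he : e ∈ atlas (Model n) M) {y : Model n} (hy : y ∈ e.target)
    (v : Model n) : chartDeriv e (e.symm y) (symmDeriv e y v) = v :=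
  DFunLike.congr_fun ((mdifferentiable_of_mem_atlas' he).comp_symm_deriv hy) v

lemma metricForm_gram (g : Metric n M) (e : OpenPartialHomeomorph M (Model n)) (y u v : Model n) :
    metricForm (gram g e) y u v = innerAt g (e.symm y) (symmDeriv e y u) (symmDeriv e y v) := by
  have : metricForm (gram g e) y
      = (innerAt g (e.symm y)).bilinearComp (symmDeriv e y) (symmDeriv e y) := by
    apply IsMetricOn.bilinear_ext
    intro i j
    rw [metricForm, bilin_stdVec, gram_apply]
    rfl
  rw [this]
  rfl

lemma gram_posDef (g : Metric n M) (he : e ∈ atlas (Model n) M) {y : Model n}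
    (hy : y ∈ e.target) : (gram g e y).PosDef := by
  refine Matrix.PosDef.of_dotProduct_mulVec_pos ?_ fun v hv => ?_
  · ext i j
    simp only [Matrix.conjTranspose_apply, gram_apply, star_trivial]
    exact innerAt_symm _ _ _ _
  · have h0 : symmDeriv e y (WithLp.toLp 2 v) ≠ 0 := by
      intro h0
      apply hv
      have := chartDeriv_symmDeriv he hy (WithLp.toLp 2 v)
      rw [h0, map_zero] at this
      simpa using congrArg (WithLp.ofLp) this.symm
    have h1 := innerAt_pos g (e.symm y) h0
    rw [← metricForm_gram, metricForm, bilin_apply] at h1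
    simp only [dotProduct, Matrix.mulVec, star_trivial, Finset.mul_sum]
    refine h1.trans_eq (Finset.sum_congr rfl fun i _ => Finset.sum_congr rfl fun j _ => ?_)
    simp only [smul_eq_mul]
    ring

lemma isMetricOn_gram (g : Metric n M) (he : e ∈ atlas (Model n) M) :
    IsMetricOn (gram g e) e.target where
  isOpen := e.open_target
  smooth i j _ hy := contDiffAt_gram g he i j hy
  symm _ _ _ _ := innerAt_symm _ _ _ _
  det_pos _ hy := (gram_posDef g he hy).det_pos

/-- The domain of the transition map from `e` to `e'`. -/
def overlap (e e' : OpenPartialHomeomorph M (Model n)) : Set (Model n) :=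
  e.target ∩ e.symm ⁻¹' e'.source

omit [ChartedSpace (Model n) M] [IsManifold (𝓡 n) ∞ M] in
lemma isOpen_overlap (e e' : OpenPartialHomeomorph M (Model n)) : IsOpen (overlap e e') :=
  e.symm.isOpen_inter_preimage e'.open_source

lemma contDiffAt_transition (he : e ∈ atlas (Model n) M) (he' : e' ∈ atlas (Model n) M)
    {y : Model n} (hy : y ∈ overlap e e') : ContDiffAt ℝ ∞ (e' ∘ e.symm) y :=
  contMDiffAt_iff_contDiffAt.1 (ContMDiffAt.comp y
    ((contMDiffOn_of_mem_atlas he').contMDiffAt (e'.open_source.mem_nhds hy.2))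
    ((contMDiffOn_symm_of_mem_atlas he).contMDiffAt (e.open_target.mem_nhds hy.1)))

lemma fderiv_transition (he : e ∈ atlas (Model n) M) (he' : e' ∈ atlas (Model n) M)
    {y : Model n} (hy : y ∈ overlap e e') (v : Model n) :
    fderiv ℝ (e' ∘ e.symm) y v = chartDeriv e' (e.symm y) (symmDeriv e y v) := by
  rw [← mfderiv_eq_fderiv, mfderiv_comp (I' := 𝓡 n) y
    ((mdifferentiable_of_mem_atlas' he').mdifferentiableAt hy.2)
    ((mdifferentiable_of_mem_atlas' he).mdifferentiableAt_symm hy.1)]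
  rfl

/-- Both coordinate metrics represent the same `g`. Chart independence of R, W and the volume
density all rests on this. -/
lemma isIsometryOn_transition (g : Metric n M) (he : e ∈ atlas (Model n) M)
    (he' : e' ∈ atlas (Model n) M) :
    IsIsometryOn (metricForm (gram g e)) (metricForm (gram g e')) (e' ∘ e.symm)
      (overlap e e') e'.target where
  mapsTo _ hy := e'.map_source hy.2
  smooth _ hy := contDiffAt_transition he he' hy
  pullback y hy u v := by
    rw [metricForm_gram, metricForm_gram, fderiv_transition he he' hy,
      fderiv_transition he he' hy, Function.comp_apply, symmDeriv_chartDeriv he' hy.2,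
      symmDeriv_chartDeriv he' hy.2, e'.left_inv hy.2]

lemma vecCoord_transition (V : ∀ x : M, TangentSpace (𝓡 n) x) (he : e ∈ atlas (Model n) M)
    (he' : e' ∈ atlas (Model n) M) {y : Model n} (hy : y ∈ overlap e e') :
    vecCoord V e' ((e' ∘ e.symm) y) = fderiv ℝ (e' ∘ e.symm) y (vecCoord V e y) := by
  have h (e : OpenPartialHomeomorph M (Model n)) (y : Model n) :
    vecCoord V e y = chartDeriv e (e.symm y) (V (e.symm y)) := rfl
  have hx := e.map_target hy.1
  have h2 := symmDeriv_chartDeriv he hx (V (e.symm y))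
  rw [e.right_inv hy.1] at h2
  rw [fderiv_transition he he' hy, h, h, h2, Function.comp_apply, e'.left_inv hy.2]

lemma IsMetricOn.mono {G : Model n → Matrix (Fin n) (Fin n) ℝ} {U U' : Set (Model n)}
    (h : IsMetricOn G U) (hU' : IsOpen U') (hUU' : U' ⊆ U) : IsMetricOn G U' where
  isOpen := hU'
  smooth i j y hy := h.smooth i j y (hUU' hy)
  symm y hy := h.symm y (hUU' hy)
  det_pos y hy := h.det_pos y (hUU' hy)

lemma isMetricOn_gram_overlap (g : Metric n M) (he : e ∈ atlas (Model n) M) :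
    IsMetricOn (gram g e) (overlap e e') :=
  (isMetricOn_gram g he).mono (isOpen_overlap e e') Set.inter_subset_left

/-- The scalar curvature does not depend on the chart. -/
lemma scalarCurvature_eq (g : Metric n M) (he : e ∈ atlas (Model n) M) {y : Model n}
    (hy : y ∈ e.target) : scalarCurvature g (e.symm y) = scalarCoord (gram g e) y := by
  set e' := chartAt (Model n) (e.symm y)
  have he' : e' ∈ atlas (Model n) M := chart_mem_atlas _ _
  have hy' : y ∈ overlap e e' := ⟨hy, mem_chart_source _ _⟩
  have h := isMetricOn_gram_overlap (e' := e') g he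
  have h' := isMetricOn_gram g he'
  have hψ := isIsometryOn_transition g he he'
  rw [h.scalarCoord_eq hy', hψ.scalarTrace_eq h.isLeviCivitaOn h'.isLeviCivitaOn hy',
    ← h'.scalarCoord_eq (hψ.mapsTo hy')]
  rfl

/-- The Einstein tensor applied to `V`, in the chart `e`. -/
def einsteinCoord (g : Metric n M) (V : ∀ x : M, TangentSpace (𝓡 n) x)
    (e : OpenPartialHomeomorph M (Model n)) : Model n → Model n :=
  einsteinField (connForm (gram g e)) (dualVec (gram g e)) (vecCoord V e)

lemma contDiffAt_einsteinCoord (g : Metric n M) {V : ∀ x : M, TangentSpace (𝓡 n) x}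
    (hV : IsSmoothVectorField V) (he : e ∈ atlas (Model n) M) {y : Model n} (hy : y ∈ e.target) :
    ContDiffAt ℝ ∞ (einsteinCoord g V e) y :=
  (isMetricOn_gram g he).isLeviCivitaOn.contDiffAt_einsteinField hy
    (contDiffAt_vecCoord hV he hy)

/-- The components of W transform as those of a vector field, which replaces a construction of W on
the manifold. -/
lemma einsteinCoord_transition (g : Metric n M) (V : ∀ x : M, TangentSpace (𝓡 n) x)
    (he : e ∈ atlas (Model n) M) (he' : e' ∈ atlas (Model n) M) {y : Model n}
    (hy : y ∈ overlap e e') : einsteinCoord g V e' ((e' ∘ e.symm) y)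
      = fderiv ℝ (e' ∘ e.symm) y (einsteinCoord g V e y) :=
  (isIsometryOn_transition g he he').einsteinField_eq
    (isMetricOn_gram_overlap g he).isLeviCivitaOn (isMetricOn_gram g he').isLeviCivitaOn hy
    (vecCoord_transition V he he' hy)

lemma sqrt_det_gram_transition (g : Metric n M) (he : e ∈ atlas (Model n) M)
    (he' : e' ∈ atlas (Model n) M) {y : Model n} (hy : y ∈ overlap e e') :
    √(gram g e y).det
      = |(fderiv ℝ (e' ∘ e.symm) y).det| * √(gram g e' ((e' ∘ e.symm) y)).det :=
  sqrt_det_eq_of_isometry (isIsometryOn_transition g he he') hy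

end

/-! ### The Riemannian volume measure. -/

section

open MeasureTheory Set

variable {n : ℕ} {M : Type*} [TopologicalSpace M] [ChartedSpace (Model n) M]
  [IsManifold (𝓡 n) ∞ M] [MeasurableSpace M] [BorelSpace M]
  {e e' : OpenPartialHomeomorph M (Model n)} (g : Metric n M)

omit [ChartedSpace (Model n) M] [IsManifold (𝓡 n) ∞ M] in
lemma aemeasurable_symm (e : OpenPartialHomeomorph M (Model n)) (μ : Measure (Model n)) :
    AEMeasurable e.symm (μ.restrict e.target) :=
  e.continuousOn_symm.aemeasurable e.open_target.measurableSet

omit [ChartedSpace (Model n) M] [IsManifold (𝓡 n) ∞ M] in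
lemma measurableSet_preimage_symm (e : OpenPartialHomeomorph M (Model n)) {A : Set M}
    (hA : MeasurableSet A) : MeasurableSet (e.symm ⁻¹' A ∩ e.target) := by
  have h1 : Measurable (fun y : e.target => e.symm y) :=
    (continuousOn_iff_continuous_domRestrict.1 e.continuousOn_symm).measurable
  have h2 := e.open_target.measurableSet.subtype_image (h1 hA)
  convert h2 using 1
  ext y
  simp [and_comm]

lemma chartVolume_apply {A : Set M} (hA : MeasurableSet A) : chartVolume g e A
    = ∫⁻ y in e.symm ⁻¹' A ∩ e.target, ENNReal.ofReal (√(gram g e y).det) := by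
  rw [chartVolume, Measure.map_apply_of_aemeasurable _ hA, withDensity_apply',
    Measure.restrict_restrict' e.open_target.measurableSet]
  exact (aemeasurable_symm e volume).mono_ac (withDensity_absolutelyContinuous _ _)

lemma chartVolume_inter_source {A : Set M} (hA : MeasurableSet A) :
    chartVolume g e (A ∩ e.source) = chartVolume g e A := by
  rw [chartVolume_apply g hA, chartVolume_apply g (hA.inter e.open_source.measurableSet)]
  congr 2
  ext y
  simp only [mem_inter_iff, mem_preimage]
  exact ⟨fun h => ⟨h.1.1, h.2⟩, fun h => ⟨⟨h.1, e.map_target h.2⟩, h.2⟩⟩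

/-- The measures `chartVolume g e` agree on overlaps. -/
lemma chartVolume_eq_of_subset (he : e ∈ atlas (Model n) M) (he' : e' ∈ atlas (Model n) M)
    {A : Set M} (hA : MeasurableSet A) (hAe : A ⊆ e.source) (hAe' : A ⊆ e'.source) :
    chartVolume g e A = chartVolume g e' A := by
  rw [chartVolume_apply g hA, chartVolume_apply g hA]
  set S := e.symm ⁻¹' A ∩ e.target with hS
  have hSU : S ⊆ overlap e e' := fun y hy => ⟨hy.2, hAe' hy.1⟩
  have himg : (e' ∘ e.symm) '' S = e'.symm ⁻¹' A ∩ e'.target := by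
    ext z
    constructor
    · rintro ⟨y, hy, rfl⟩
      refine ⟨?_, e'.map_source (hSU hy).2⟩
      simp only [mem_preimage, Function.comp_apply, e'.left_inv (hSU hy).2]
      exact hy.1
    · rintro ⟨hz, hz'⟩
      refine ⟨e (e'.symm z), ⟨?_, e.map_source (hAe hz)⟩, ?_⟩
      · simp only [mem_preimage, e.left_inv (hAe hz)]
        exact hz
      · simp only [Function.comp_apply, e.left_inv (hAe hz), e'.right_inv hz']
  have hinj : InjOn (e' ∘ e.symm) S := by
    intro y hy z hz hyz
    have h1 := e'.injOn (hSU hy).2 (hSU hz).2 hyz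
    exact e.symm.injOn hy.2 hz.2 h1
  rw [← himg, lintegral_image_eq_lintegral_abs_det_fderiv_mul volume
    (measurableSet_preimage_symm e hA) (fun y hy => ((contDiffAt_transition he he'
      (hSU hy)).differentiableAt (by simp)).hasFDerivAt.hasFDerivWithinAt) hinj]
  refine setLIntegral_congr_fun (measurableSet_preimage_symm e hA) fun y hy => ?_
  rw [sqrt_det_gram_transition g he he' (hSU hy), ENNReal.ofReal_mul (abs_nonneg _)]

/-- The supremum is bounded by the measure equal to `chartVolume g e` on the chart domain and to the
top measure off it; every chart measure lies below this because they agree on overlaps. -/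
lemma volumeMeasure_apply_of_subset (he : e ∈ atlas (Model n) M) {A : Set M}
    (hA : MeasurableSet A) (hAe : A ⊆ e.source) : volumeMeasure g A = chartVolume g e A := by
  apply le_antisymm
  · have hs := e.open_source.measurableSet
    have hle : volumeMeasure g ≤ chartVolume g e + (⊤ : Measure M).restrict e.sourceᶜ := by
      refine iSup₂_le fun e' he' => Measure.le_iff.2 fun C hC => ?_
      rw [← measure_inter_add_sdiff C hs, Measure.add_apply, Measure.restrict_apply hC,
        ← sdiff_eq_compl_inter.trans (inter_comm _ _)]
      refine add_le_add ?_ (Measure.le_iff'.1 le_top _)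
      rw [← chartVolume_inter_source g (hC.inter hs), chartVolume_eq_of_subset g he' he
        ((hC.inter hs).inter e'.open_source.measurableSet) inter_subset_right
        (inter_subset_left.trans inter_subset_right)]
      exact measure_mono (inter_subset_left.trans inter_subset_left)
    refine (Measure.le_iff.1 hle A hA).trans_eq ?_
    rw [Measure.add_apply, Measure.restrict_apply hA, ← sdiff_eq_compl_inter.trans (inter_comm _ _),
      sdiff_eq_empty.2 hAe, measure_empty, add_zero]
  · exact Measure.le_iff'.1 (le_iSup₂ (f := fun e (_ : e ∈ atlas (Model n) M) =>
      chartVolume g e) e he) A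

lemma volumeMeasure_restrict_source (he : e ∈ atlas (Model n) M) :
    (volumeMeasure g).restrict e.source = chartVolume g e := by
  ext A hA
  have hs := e.open_source.measurableSet
  rw [Measure.restrict_apply hA, volumeMeasure_apply_of_subset g he (hA.inter hs)
    inter_subset_right, chartVolume_inter_source g hA]

omit [MeasurableSpace M] [BorelSpace M] in
lemma continuousOn_sqrt_det (he : e ∈ atlas (Model n) M) :
    ContinuousOn (fun y => √(gram g e y).det) e.target := fun _ hy =>
  ((isMetricOn_gram g he).contDiffAt_sqrt_det hy).continuousAt.continuousWithinAt

/-- The integral of a function supported in a chart domain, computed in the chart. -/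
lemma integral_volumeMeasure_eq (he : e ∈ atlas (Model n) M) {f : M → ℝ} (hf : Continuous f)
    (hfe : ∀ x ∉ e.source, f x = 0) : ∫ x, f x ∂(volumeMeasure g)
      = ∫ y in e.target, √(gram g e y).det * f (e.symm y) := by
  rw [← setIntegral_eq_integral_of_forall_compl_eq_zero hfe, volumeMeasure_restrict_source g he,
    chartVolume, integral_map _ hf.aestronglyMeasurable,
    integral_withDensity_eq_integral_toReal_smul₀]
  · simp [ENNReal.toReal_ofReal (Real.sqrt_nonneg _)]
  · exact ((continuousOn_sqrt_det g he).aemeasurable e.open_target.measurableSet).ennreal_ofReal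
  · simp
  · exact (aemeasurable_symm e volume).mono_ac (withDensity_absolutelyContinuous _ _)

/-- Locally the continuous density is bounded on a small coordinate ball of finite Lebesgue measure;
compactness does the rest. -/
lemma isFiniteMeasure_volumeMeasure [CompactSpace M] : IsFiniteMeasure (volumeMeasure g) := by
  have : IsLocallyFiniteMeasure (volumeMeasure g) := by
    refine ⟨fun x => ?_⟩
    set e := chartAt (Model n) x
    have he : e ∈ atlas (Model n) M := chart_mem_atlas _ x
    have hx : x ∈ e.source := mem_chart_source _ x
    have hc := (continuousOn_sqrt_det g he).continuousAt (e.open_target.mem_nhds (e.map_source hx))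
    have h1 : ∀ᶠ y in nhds (e x), √(gram g e y).det < √(gram g e (e x)).det + 1 :=
      hc.eventually_lt_const (by linarith)
    obtain ⟨r, hr, hrs⟩ := _root_.Metric.eventually_nhds_iff_ball.1 h1
    set A := e.source ∩ e ⁻¹' (_root_.Metric.ball (e x) r)
    have hAo : IsOpen A := e.isOpen_inter_preimage _root_.Metric.isOpen_ball
    refine ⟨A, hAo.mem_nhds ⟨hx, _root_.Metric.mem_ball_self hr⟩, ?_⟩
    rw [volumeMeasure_apply_of_subset g he hAo.measurableSet inter_subset_left,
      chartVolume_apply g hAo.measurableSet]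
    have hsub : ∀ y ∈ e.symm ⁻¹' A ∩ e.target, y ∈ _root_.Metric.ball (e x) r := by
      rintro y ⟨⟨-, hy⟩, hy'⟩
      rwa [mem_preimage, e.right_inv hy'] at hy
    calc _ ≤ ∫⁻ _ in e.symm ⁻¹' A ∩ e.target, ENNReal.ofReal (√(gram g e (e x)).det + 1) :=
          setLIntegral_mono' (measurableSet_preimage_symm e hAo.measurableSet) fun y hy =>
            ENNReal.ofReal_le_ofReal (hrs y (hsub y hy)).le
      _ ≤ _ := lintegral_mono_set hsub
      _ < ⊤ := by
        rw [setLIntegral_const]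
        exact ENNReal.mul_lt_top ENNReal.ofReal_lt_top measure_ball_lt_top
  exact CompactSpace.isFiniteMeasure

lemma volumeMeasure_univ_pos [Nonempty M] : 0 < volumeMeasure g univ := by
  obtain ⟨x⟩ := ‹Nonempty M›
  set e := chartAt (Model n) x
  have he : e ∈ atlas (Model n) M := chart_mem_atlas _ x
  have hx : x ∈ e.source := mem_chart_source _ x
  refine lt_of_lt_of_le ?_ (measure_mono (subset_univ e.source))
  rw [volumeMeasure_apply_of_subset g he e.open_source.measurableSet subset_rfl,
    chartVolume_apply g e.open_source.measurableSet]
  have hS : e.symm ⁻¹' e.source ∩ e.target = e.target :=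
    inter_eq_right.2 fun y hy => e.map_target hy
  rw [hS, pos_iff_ne_zero, Ne, lintegral_eq_zero_iff'
    ((continuousOn_sqrt_det g he).aemeasurable e.open_target.measurableSet).ennreal_ofReal]
  intro h0
  have h1 : ∀ᵐ y ∂(volume.restrict e.target), False := by
    filter_upwards [h0, ae_restrict_mem e.open_target.measurableSet] with y hy hyt
    have := Real.sqrt_pos.2 ((isMetricOn_gram g he).det_pos y hyt)
    simp only [Pi.zero_apply, ENNReal.ofReal_eq_zero] at hy
    linarith
  simp only [Filter.eventually_false_iff_eq_bot, ae_eq_bot, Measure.restrict_eq_zero] at h1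
  exact (e.open_target.measure_pos volume ⟨e x, e.map_source hx⟩).ne' h1

end

/-! ### Integration by parts in charts and the partition of unity. -/

section

open MeasureTheory Set

/-- Integration by parts against the constant function 1. -/
lemma integral_fderiv_eq_zero {n : ℕ} {f : Model n → ℝ} (hf : ContDiff ℝ 1 f)
    (hc : HasCompactSupport f) (v : Model n) : ∫ y, fderiv ℝ f y v = 0 := by
  have h1 : Integrable (fun y => fderiv ℝ f y v) :=
    (((hf.continuous_fderiv (by simp)).clm_apply continuous_const).integrable_of_hasCompactSupport
      (hc.fderiv_apply ℝ v))
  have h2 : Integrable f := hf.continuous.integrable_of_hasCompactSupport hc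
  have := integral_mul_fderiv_eq_neg_fderiv_mul_of_integrable (μ := volume)
    (f := fun _ : Model n => (1 : ℝ)) (g := f) (v := v) (by simp) (by simpa using h1)
    (by simpa using h2) (fun _ _ => differentiableAt_const _)
    (fun y _ => hf.differentiable (by simp) y)
  simpa using this

variable {n : ℕ} {M : Type*} [TopologicalSpace M] [ChartedSpace (Model n) M]
  {e : OpenPartialHomeomorph M (Model n)}

lemma continuous_of_continuousAt_comp_symm {f : M → ℝ}
    (h : ∀ e ∈ atlas (Model n) M, ∀ y ∈ e.target, ContinuousAt (f ∘ e.symm) y) :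
    Continuous f := by
  rw [continuous_iff_continuousAt]
  intro x
  set e := chartAt (Model n) x
  have hx : x ∈ e.source := mem_chart_source _ x
  have h1 : ContinuousAt ((f ∘ e.symm) ∘ e) x :=
    (h e (chart_mem_atlas _ x) (e x) (e.map_source hx)).comp (e.continuousAt hx)
  refine h1.congr ?_
  filter_upwards [e.open_source.mem_nhds hx] with z hz
  simp [e.left_inv hz]

variable [IsManifold (𝓡 n) ∞ M] (g : Metric n M)

lemma continuous_scalarCurvature : Continuous (scalarCurvature g) := by
  refine continuous_of_continuousAt_comp_symm (n := n) fun e he y hy => ?_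
  have hM := isMetricOn_gram g he
  refine ((hM.isLeviCivitaOn.contDiffAt_scalarTrace hy).continuousAt).congr ?_
  filter_upwards [e.open_target.mem_nhds hy] with z hz
  rw [Function.comp_apply, scalarCurvature_eq g he hz, hM.scalarCoord_eq hz]

lemma contDiffAt_comp_symm {f : M → ℝ} (hf : ContMDiff (𝓡 n) 𝓘(ℝ) ∞ f)
    (he : e ∈ atlas (Model n) M) {y : Model n} (hy : y ∈ e.target) :
    ContDiffAt ℝ ∞ (f ∘ e.symm) y :=
  contMDiffAt_iff_contDiffAt.1 (hf.contMDiffAt.comp y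
    ((contMDiffOn_symm_of_mem_atlas he).contMDiffAt (e.open_target.mem_nhds hy)))

/-- The derivative of `f` along the vector field `Ric(V) - (R / 2) V`. -/
def einsteinDeriv (V : ∀ x : M, TangentSpace (𝓡 n) x) (f : M → ℝ) (x : M) : ℝ :=
  fderiv ℝ (f ∘ (chartAt (Model n) x).symm) (chartAt (Model n) x x)
    (einsteinCoord g V (chartAt (Model n) x) (chartAt (Model n) x x))

/-- Chain rule together with the transition law of W: the derivation W f is independent of the
chart. -/
lemma einsteinDeriv_eq (V : ∀ x : M, TangentSpace (𝓡 n) x) {f : M → ℝ}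
    (hf : ContMDiff (𝓡 n) 𝓘(ℝ) ∞ f) (he : e ∈ atlas (Model n) M) {y : Model n}
    (hy : y ∈ e.target) : einsteinDeriv g V f (e.symm y)
      = fderiv ℝ (f ∘ e.symm) y (einsteinCoord g V e y) := by
  set e' := chartAt (Model n) (e.symm y) with he'def
  have he' : e' ∈ atlas (Model n) M := chart_mem_atlas _ _
  have hy' : y ∈ overlap e e' := ⟨hy, mem_chart_source _ _⟩
  have h1 : f ∘ e.symm =ᶠ[nhds y] (f ∘ e'.symm) ∘ (e' ∘ e.symm) := by
    filter_upwards [(isOpen_overlap e e').mem_nhds hy'] with z hz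
    simp [e'.left_inv hz.2]
  have h2 := (contDiffAt_comp_symm hf he' (e'.map_source hy'.2)).differentiableAt (by simp)
  rw [h1.fderiv_eq, fderiv_comp y h2 ((contDiffAt_transition he he' hy').differentiableAt (by simp)),
    ContinuousLinearMap.comp_apply, ← einsteinCoord_transition g V he he' hy']
  rfl

lemma continuous_einsteinDeriv {V : ∀ x : M, TangentSpace (𝓡 n) x} (hV : IsSmoothVectorField V)
    {f : M → ℝ} (hf : ContMDiff (𝓡 n) 𝓘(ℝ) ∞ f) : Continuous (einsteinDeriv g V f) := by
  refine continuous_of_continuousAt_comp_symm (n := n) fun e he y hy => ?_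
  have h : ContDiffAt ℝ ∞ (fun y => fderiv ℝ (f ∘ e.symm) y (einsteinCoord g V e y)) y :=
    (contDiffAt_fderiv_top (contDiffAt_comp_symm hf he hy)).clm_apply
      (contDiffAt_einsteinCoord g hV he hy)
  refine h.continuousAt.congr ?_
  filter_upwards [e.open_target.mem_nhds hy] with z hz using (einsteinDeriv_eq g V hf he hz).symm

lemma einsteinDeriv_eq_zero (V : ∀ x : M, TangentSpace (𝓡 n) x) {f : M → ℝ} {x : M}
    (hx : x ∉ tsupport f) : einsteinDeriv g V f x = 0 := by
  set e := chartAt (Model n) x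
  have hxe : x ∈ e.source := mem_chart_source _ x
  have h1 : f ∘ e.symm =ᶠ[nhds (e x)] fun _ => 0 := by
    have h2 : ∀ᶠ z in nhds (e.symm (e x)), f z = 0 := by
      rw [e.left_inv hxe]
      exact notMem_tsupport_iff_eventuallyEq.1 hx
    exact (e.continuousAt_symm (e.map_source hxe)).eventually h2
  simp only [einsteinDeriv]
  rw [h1.fderiv_eq]
  simp

/-- A derivation kills the constant 1. -/
lemma sum_einsteinDeriv_eq_zero (V : ∀ x : M, TangentSpace (𝓡 n) x) {ι : Type*} [Fintype ι]
    {ρ : ι → M → ℝ} (hρ : ∀ k, ContMDiff (𝓡 n) 𝓘(ℝ) ∞ (ρ k)) (h1 : ∀ x, ∑ k, ρ k x = 1)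
    (x : M) : ∑ k, einsteinDeriv g V (ρ k) x = 0 := by
  set e := chartAt (Model n) x
  have hx := e.map_source (mem_chart_source (Model n) x)
  have hd (k : ι) : HasFDerivAt (ρ k ∘ e.symm) (fderiv ℝ (ρ k ∘ e.symm) (e x)) (e x) :=
    ((contDiffAt_comp_symm (hρ k) (chart_mem_atlas _ x) hx).differentiableAt
      (by simp)).hasFDerivAt
  have hs := HasFDerivAt.fun_sum (u := Finset.univ) fun k _ => hd k
  simp only [Function.comp_apply, h1] at hs
  have := hs.unique (hasFDerivAt_const (1 : ℝ) (e x))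
  have h2 := DFunLike.congr_fun this (einsteinCoord g V e (e x))
  simpa [einsteinDeriv] using h2

variable [MeasurableSpace M] [BorelSpace M] [CompactSpace M]

/-- Divergence theorem for ρW, supported in one chart: div(ρW) = ρ div W + Wρ, with div W known from
the soliton equation. -/
lemma integral_mul_eq_neg_integral_einsteinDeriv {V : ∀ x : M, TangentSpace (𝓡 n) x} {c : ℝ}
    (hsol : IsYamabeSoliton g V c) (he : e ∈ atlas (Model n) M) {ρ : M → ℝ}
    (hρ : ContMDiff (𝓡 n) 𝓘(ℝ) ∞ ρ) (hρe : tsupport ρ ⊆ e.source) :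
    ∫ x, ρ x * ((1 - n / 2) * (-c + scalarCurvature g x) * scalarCurvature g x)
        ∂(volumeMeasure g) = - ∫ x, einsteinDeriv g V ρ x ∂(volumeMeasure g) := by
  have hM := isMetricOn_gram g he
  have hR := continuous_scalarCurvature g
  have hne : ∀ x ∉ e.source, x ∉ tsupport ρ := fun x hx hx' => hx (hρe hx')
  have hKt : IsOpen e.target := e.open_target
  set K := e '' tsupport ρ
  have hKc : IsCompact K := (isClosed_tsupport ρ).isCompact.image_of_continuousOn
    (e.continuousOn.mono hρe)
  have hKsub : K ⊆ e.target := by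
    rintro _ ⟨x, hx, rfl⟩
    exact e.map_source (hρe hx)
  let w (i : Fin n) (y : Model n) : ℝ := √(gram g e y).det * einsteinCoord g V e y i
  have hw (i : Fin n) {y : Model n} (hy : y ∈ e.target) : ContDiffAt ℝ ∞ (w i) y :=
    (hM.contDiffAt_sqrt_det hy).mul
      ((EuclideanSpace.proj i : Model n →L[ℝ] ℝ).contDiff.contDiffAt.comp y
        (contDiffAt_einsteinCoord g hsol.smooth he hy))
  -- Extended by zero to ℝⁿ. This stays smooth because it vanishes off the compact set `K`, which
  -- lies inside the open set `e.target`.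
  let h (i : Fin n) : Model n → ℝ := e.target.indicator fun y => (ρ ∘ e.symm) y * w i y
  have hzero (i : Fin n) : ∀ y ∉ K, h i y = 0 := by
    intro y hy
    by_cases hyt : y ∈ e.target
    · have : ρ (e.symm y) = 0 := by
        by_contra h0
        exact hy ⟨e.symm y, subset_tsupport ρ h0, e.right_inv hyt⟩
      simp [h, hyt, this]
    · simp [h, hyt]
  have heq (i : Fin n) {y : Model n} (hy : y ∈ e.target) :
      h i =ᶠ[nhds y] fun y => (ρ ∘ e.symm) y * w i y := by
    filter_upwards [hKt.mem_nhds hy] with z hz using indicator_of_mem hz _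
  have heq0 (i : Fin n) {y : Model n} (hy : y ∉ e.target) : h i =ᶠ[nhds y] fun _ => 0 := by
    filter_upwards [hKc.isClosed.isOpen_compl.mem_nhds fun hy' => hy (hKsub hy')] with z hz
      using hzero i z hz
  have hsm (i : Fin n) : ContDiff ℝ ∞ (h i) := by
    rw [contDiff_iff_contDiffAt]
    intro y
    by_cases hy : y ∈ e.target
    · exact ((contDiffAt_comp_symm hρ he hy).mul (hw i hy)).congr_of_eventuallyEq (heq i hy)
    · exact contDiffAt_const.congr_of_eventuallyEq (heq0 i hy)
  have hcs (i : Fin n) : HasCompactSupport (h i) := HasCompactSupport.intro hKc (hzero i)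
  have hint (i : Fin n) : Integrable (fun y => fderiv ℝ (h i) y (stdVec i)) :=
    ((((hsm i).continuous_fderiv (by simp)).clm_apply
      continuous_const).integrable_of_hasCompactSupport ((hcs i).fderiv_apply ℝ (stdVec i)))
  have htot : ∫ y in e.target, ∑ i, fderiv ℝ (h i) y (stdVec i) = 0 := by
    rw [setIntegral_eq_integral_of_forall_compl_eq_zero, integral_finsetSum _ fun i _ => hint i]
    · exact Finset.sum_eq_zero fun i _ =>
        integral_fderiv_eq_zero ((hsm i).of_le (by simp)) (hcs i) _
    · intro y hy
      refine Finset.sum_eq_zero fun i _ => ?_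
      rw [(heq0 i hy).fderiv_eq]
      simp
  have hpt : ∀ y ∈ e.target, ∑ i, fderiv ℝ (h i) y (stdVec i)
      = √(gram g e y).det * (ρ (e.symm y) * ((1 - n / 2) * (-c + scalarCurvature g (e.symm y))
          * scalarCurvature g (e.symm y)))
        + √(gram g e y).det * einsteinDeriv g V ρ (e.symm y) := by
    intro y hy
    have hdiv := hM.sum_partialDeriv_einsteinField hy (contDiffAt_vecCoord hsol.smooth he hy)
      (hsol.lieDeriv_eq e he y hy)
    have hterm (i : Fin n) : fderiv ℝ (h i) y (stdVec i)
        = ρ (e.symm y) * fderiv ℝ (w i) y (stdVec i)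
          + w i y * fderiv ℝ (ρ ∘ e.symm) y (stdVec i) := by
      have d1 := ((contDiffAt_comp_symm hρ he hy).differentiableAt (by simp)).hasFDerivAt
      have d2 := ((hw i hy).differentiableAt (by simp)).hasFDerivAt
      rw [(heq i hy).fderiv_eq, (d1.fun_mul d2).fderiv]
      simp
    have hwi : ∑ i, fderiv ℝ (w i) y (stdVec i) = _ := hdiv
    simp only [hterm, Finset.sum_add_distrib, ← Finset.mul_sum]
    rw [hwi, ← scalarCurvature_eq g he hy, einsteinDeriv_eq g V hρ he hy,
      ← sum_apply_smul_map_stdVec (fderiv ℝ (ρ ∘ e.symm) y)]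
    simp only [w, Finset.mul_sum, smul_eq_mul, mul_assoc]
    ring
  have hFc : Continuous fun x =>
      ρ x * ((1 - n / 2) * (-c + scalarCurvature g x) * scalarCurvature g x) :=
    hρ.continuous.mul ((continuous_const.mul (continuous_const.add hR)).mul hR)
  have hDc := continuous_einsteinDeriv g hsol.smooth hρ
  have := isFiniteMeasure_volumeMeasure g
  rw [← add_eq_zero_iff_eq_neg, ← integral_add
    (hFc.integrable_of_hasCompactSupport (HasCompactSupport.of_compactSpace _))
    (hDc.integrable_of_hasCompactSupport (HasCompactSupport.of_compactSpace _)),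
    integral_volumeMeasure_eq g he
      (f := fun x => ρ x * ((1 - n / 2) * (-c + scalarCurvature g x) * scalarCurvature g x)
        + einsteinDeriv g V ρ x) (hFc.add hDc)]
  · rw [← htot]
    refine setIntegral_congr_fun hKt.measurableSet fun y hy => ?_
    rw [hpt y hy]
    ring
  · intro x hx
    rw [einsteinDeriv_eq_zero g V (hne x hx), image_eq_zero_of_notMem_tsupport (hne x hx)]
    simp

variable [T2Space M] in
/-- On a compact Yamabe soliton, `∫ (1 - n / 2) (R - c) R = 0`. -/
lemma integral_mul_scalarCurvature_eq_zero {V : ∀ x : M, TangentSpace (𝓡 n) x} {c : ℝ}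
    (hsol : IsYamabeSoliton g V c) :
    ∫ x, (1 - n / 2) * (-c + scalarCurvature g x) * scalarCurvature g x
      ∂(volumeMeasure g) = 0 := by
  have hR := continuous_scalarCurvature g
  have := isFiniteMeasure_volumeMeasure g
  have hi {f : M → ℝ} (hf : Continuous f) : Integrable f (volumeMeasure g) :=
    hf.integrable_of_hasCompactSupport (HasCompactSupport.of_compactSpace _)
  -- A finite cover gives a partition of unity with a finite index type, so sums commute with
  -- integrals and derivatives.
  obtain ⟨t, ht⟩ := isCompact_univ.elim_finite_subcover
    (fun x : M => (chartAt (Model n) x).source) (fun x => (chartAt (Model n) x).open_source)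
    fun x _ => mem_iUnion.2 ⟨x, mem_chart_source _ x⟩
  obtain ⟨ρ, hρ⟩ := SmoothPartitionOfUnity.exists_isSubordinate (𝓡 n) isClosed_univ
    (fun x : t => (chartAt (Model n) (x : M)).source) (fun x => (chartAt _ _).open_source)
    (by simpa [iUnion_subtype] using ht)
  have hsum (x : M) : ∑ k, ρ k x = 1 := by
    rw [← finsum_eq_sum_of_fintype]
    exact ρ.sum_eq_one (mem_univ x)
  have hF : Continuous fun x =>
      (1 - n / 2 : ℝ) * (-c + scalarCurvature g x) * scalarCurvature g x := by fun_prop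
  calc _ = ∫ x, ∑ k, ρ k x * ((1 - n / 2) * (-c + scalarCurvature g x) * scalarCurvature g x)
        ∂(volumeMeasure g) := by simp only [← Finset.sum_mul, hsum, one_mul]
    _ = ∑ k, - ∫ x, einsteinDeriv g V (ρ k) x ∂(volumeMeasure g) := by
      rw [integral_finsetSum _ fun k _ => hi (f := fun x => ρ k x * ((1 - n / 2)
        * (-c + scalarCurvature g x) * scalarCurvature g x))
        ((ρ k).contMDiff.continuous.mul hF)]
      exact Finset.sum_congr rfl fun k _ => integral_mul_eq_neg_integral_einsteinDeriv g hsol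
        (chart_mem_atlas _ _) (ρ k).contMDiff (hρ k)
    _ = 0 := by
      rw [Finset.sum_neg_distrib, ← integral_finsetSum _ fun k _ =>
        hi (continuous_einsteinDeriv g hsol.smooth (ρ k).contMDiff)]
      simp only [sum_einsteinDeriv_eq_zero g V (fun k => (ρ k).contMDiff) hsum, integral_zero,
        neg_zero]

end

end YamabeSoliton

end

/-! ### The integral identity and the sign of c. -/

theorem mainTheorem1 {n : ℕ} (hn : 3 ≤ n)
    {M : Type*} [TopologicalSpace M] [ChartedSpace (YamabeSoliton.Model n) M]
    [IsManifold (𝓡 n) ∞ M] [T2Space M] [CompactSpace M] [Nonempty M]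
    [MeasurableSpace M] [BorelSpace M]
    (g : YamabeSoliton.Metric n M) (V : ∀ x : M, TangentSpace (𝓡 n) x) (c : ℝ)
    (hsol : YamabeSoliton.IsYamabeSoliton g V c) :
    MeasureTheory.Integrable (YamabeSoliton.scalarCurvature g) (YamabeSoliton.volumeMeasure g) ∧
    MeasureTheory.Integrable (fun x => YamabeSoliton.scalarCurvature g x ^ 2)
      (YamabeSoliton.volumeMeasure g) ∧
    c * (∫ x, YamabeSoliton.scalarCurvature g x ∂(YamabeSoliton.volumeMeasure g))
      = ∫ x, YamabeSoliton.scalarCurvature g x ^ 2 ∂(YamabeSoliton.volumeMeasure g) ∧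
    ((∫ x, YamabeSoliton.scalarCurvature g x ∂(YamabeSoliton.volumeMeasure g)) ≠ 0 →
      c = (∫ x, YamabeSoliton.scalarCurvature g x ^ 2 ∂(YamabeSoliton.volumeMeasure g))
        / ∫ x, YamabeSoliton.scalarCurvature g x ∂(YamabeSoliton.volumeMeasure g)) ∧
    ∀ α : ℝ, 0 < α → (∀ x : M, α ≤ YamabeSoliton.scalarCurvature g x) →
      α ≤ c ∧ YamabeSoliton.IsExpanding c := by
  have hfin := YamabeSoliton.isFiniteMeasure_volumeMeasure g
  have hR := YamabeSoliton.continuous_scalarCurvature g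
  have hi {f : M → ℝ} (hf : Continuous f) :
      MeasureTheory.Integrable f (YamabeSoliton.volumeMeasure g) :=
    hf.integrable_of_hasCompactSupport (HasCompactSupport.of_compactSpace _)
  have hi1 := hi hR
  have hi2 := hi (f := fun x => YamabeSoliton.scalarCurvature g x ^ 2) (hR.pow 2)
  have hmain : c * (∫ x, YamabeSoliton.scalarCurvature g x ∂(YamabeSoliton.volumeMeasure g))
      = ∫ x, YamabeSoliton.scalarCurvature g x ^ 2 ∂(YamabeSoliton.volumeMeasure g) := by
    have h0 := YamabeSoliton.integral_mul_scalarCurvature_eq_zero g hsol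
    -- The dimension enters only here; the factor would vanish for n = 2.
    have hn' : (1 - n / 2 : ℝ) ≠ 0 := by
      have : (3 : ℝ) ≤ n := by exact_mod_cast hn
      linarith
    simp only [mul_assoc] at h0
    rw [MeasureTheory.integral_const_mul, mul_eq_zero, or_iff_right hn'] at h0
    rw [← sub_eq_zero, ← MeasureTheory.integral_const_mul, ← MeasureTheory.integral_sub
      (hi1.const_mul c) hi2, ← neg_eq_zero, ← MeasureTheory.integral_neg, ← h0]
    congr 1
    funext x
    ring
  refine ⟨hi1, hi2, hmain, fun h0 => by rw [← hmain, mul_div_cancel_right₀ _ h0], ?_⟩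
  intro α hα hle
  -- Positive total volume makes ∫ R ≥ α vol(M) strictly positive, so that ∫ R can be cancelled at
  -- the end.
  have hvol : 0 < (YamabeSoliton.volumeMeasure g).real Set.univ :=
    ENNReal.toReal_pos (YamabeSoliton.volumeMeasure_univ_pos g).ne'
      (MeasureTheory.measure_ne_top _ _)
  have hpos : 0 < ∫ x, YamabeSoliton.scalarCurvature g x ∂(YamabeSoliton.volumeMeasure g) := by
    have h1 := MeasureTheory.integral_mono (MeasureTheory.integrable_const α) hi1 hle
    rw [MeasureTheory.integral_const, smul_eq_mul] at h1
    exact (mul_pos hvol hα).trans_le h1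
  have hge : α * (∫ x, YamabeSoliton.scalarCurvature g x ∂(YamabeSoliton.volumeMeasure g))
      ≤ ∫ x, YamabeSoliton.scalarCurvature g x ^ 2 ∂(YamabeSoliton.volumeMeasure g) := by
    rw [← MeasureTheory.integral_const_mul]
    refine MeasureTheory.integral_mono (hi1.const_mul α) hi2 fun x => ?_
    have := hle x
    simp only
    nlinarith
  rw [← hmain] at hge
  have hac : α ≤ c := le_of_mul_le_mul_right hge hpos
  exact ⟨hac, hα.trans_le hac⟩
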